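/- Let $\mathbb K$ be an algebraically closed field of characteristic zero, and let $G$ be a connected reductive linear algebraic group over $\mathbb K$ of semisimple rank one, that is, up to a finite covering $G$ is the product of $\operatorname{SL}_2$ with an algebraic torus (there is a surjective homomorphism of algebraic groups $\operatorname{SL}_2\times(\mathbb K^\times)^n\to G$ with finite kernel, for some $n\ge 0$). Let $B\subset G$ be a Borel subgroup, $T\subset B$ a maximal torus of $G$ with character lattice $\mathfrak X(T)$, and let $\alpha\in\mathfrak X(T)$ be the positive root of $G$ with respect to $B$ and $T$. Let $X$ be an affine spherical $G$-variety, i.e. a normal irreducible affine variety with a regular action of $G$ such that $B$ has an open orbit in $X$. Let $\Gamma\subset\mathfrak X(T)$ be the weight monoid of $X$, i.e. the set of all $\lambda$ such that the $G$-module $\mathbb K[X]$ contains a simple $G$-submodule with highest weight $\lambda$ (with respect to $B$), and let $\mathbb Q\Gamma$ be the $\mathbb Q$-linear span of $\Gamma$ in $\mathfrak X(T)\otimes_{\mathbb Z}\mathbb Q$. Then the following conditions are equivalent: 1. $X$ is a toric $T$-variety, i.e. $X$ is normal and irreducible and $T$ has an open orbit in $X$ (the action of $T$ need not be effective); 2.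 $\alpha\notin\mathbb Q\Gamma$. -/

import Mathlib

open scoped TensorProduct Topology

namespace AffVar

/-! Affine varieties over `K` in the language of points: a set `X` together with its `K`-algebra
`K[X]` of regular functions, regarded as an algebra of `K`-valued functions on `X`. -/

/-- The data of a `K`-algebra of regular functions on the set `X`. -/
class RegularFunctions (K X : Type*) [Field K] where
  /-- The algebra `K[X]`. -/
  reg : Subalgebra K (X → K)

section Varieties

variable (K : Type*) [Field K] {X Y : Type*}

/-- The algebra `K[X]` of regular functions on `X`. -/
abbrev coordRing (X : Type*) [RegularFunctions K X] : Subalgebra K (X → K) :=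
  RegularFunctions.reg

/-- The algebra homomorphism `f ↦ f ∘ φ`. -/
def pullback (φ : X → Y) : (Y → K) →ₐ[K] (X → K) where
  toFun f := f ∘ φ
  map_one' := rfl
  map_mul' _ _ := rfl
  map_zero' := rfl
  map_add' _ _ := rfl
  commutes' _ := rfl

/-- Evaluation of regular functions at a point. -/
def evalAt [RegularFunctions K X] (x : X) : coordRing K X →ₐ[K] K :=
  (Pi.evalAlgHom K (fun _ : X => K) x).comp (coordRing K X).val

/-- `X` is an affine variety: `K[X]` is finitely generated, and the points of `X` are exactly
the `K`-algebra homomorphisms `K[X] → K`. -/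
structure IsAffineVariety (X : Type*) [RegularFunctions K X] : Prop where
  fg : (coordRing K X).FG
  eval_bijective : Function.Bijective (evalAt K : X → (coordRing K X →ₐ[K] K))

/-- A map is regular (a morphism) if it pulls regular functions back to regular functions. -/
def IsRegularMap [RegularFunctions K X] [RegularFunctions K Y] (φ : X → Y) : Prop :=
  ∀ f ∈ coordRing K Y, pullback K φ f ∈ coordRing K X

/-- The Zariski topology: the principal open sets `{f ≠ 0}`, for `f` regular, form a base. -/
@[reducible] def zariski (X : Type*) [RegularFunctions K X] : TopologicalSpace X :=
  TopologicalSpace.generateFrom {W | ∃ f ∈ coordRing K X, W = {x | f x ≠ 0}}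

/-- The affine line. -/
instance : RegularFunctions K K where
  reg := Algebra.adjoin K {fun a : K => a}

/-- The multiplicative group `𝔾ₘ`, with regular functions the Laurent polynomials. -/
instance : RegularFunctions K Kˣ where
  reg := Algebra.adjoin K {fun u : Kˣ => (u : K), fun u : Kˣ => ((u⁻¹ : Kˣ) : K)}

/-- The group `SL₂`, with regular functions the polynomials in the matrix entries. -/
instance : RegularFunctions K (Matrix.SpecialLinearGroup (Fin 2) K) where
  reg := Algebra.adjoin K
    (Set.range fun (p : Fin 2 × Fin 2) (A : Matrix.SpecialLinearGroup (Fin 2) K) => A.1 p.1 p.2)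

/-- Regular functions on a (closed) subset are the restrictions of regular functions. -/
instance [RegularFunctions K X] (p : X → Prop) : RegularFunctions K (Subtype p) where
  reg := (coordRing K X).map (pullback K Subtype.val)

/-- Regular functions on a product are generated by those pulled back from the two factors. -/
instance [RegularFunctions K X] [RegularFunctions K Y] : RegularFunctions K (X × Y) where
  reg := (coordRing K X).map (pullback K Prod.fst) ⊔ (coordRing K Y).map (pullback K Prod.snd)

/-- Regular functions on a finite power are generated by those pulled back from the factors. -/
instance [RegularFunctions K X] (n : ℕ) : RegularFunctions K (Fin n → X) where
  reg := ⨆ i : Fin n, (coordRing K X).map (pullback K fun x : Fin n → X => x i)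

end Varieties

section Groups

variable (K : Type*) [Field K]

/-- `G` is a linear (that is, affine) algebraic group. -/
structure IsLinearAlgebraicGroup (G : Type*) [Group G] [RegularFunctions K G] : Prop where
  isAffineVariety : IsAffineVariety K G
  mul_regular : IsRegularMap K (fun p : G × G => p.1 * p.2)
  inv_regular : IsRegularMap K (fun g : G => g⁻¹)

/-- `G` is a connected reductive group of semisimple rank one: up to a finite covering it is the
product of `SL₂` with an algebraic torus, i.e. there is a surjective homomorphism of algebraic
groups with finite kernel `SL₂ × (𝔾ₘ)ⁿ → G`. -/
def HasSemisimpleRankOne (G : Type*) [Group G] [RegularFunctions K G] : Prop :=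
  ∃ (n : ℕ) (φ : Matrix.SpecialLinearGroup (Fin 2) K × (Fin n → Kˣ) →* G),
    IsRegularMap K φ ∧ Function.Surjective φ ∧ Finite φ.ker

variable {G : Type*} [Group G] [RegularFunctions K G]

/-- A closed subgroup that is connected and solvable. -/
structure IsClosedConnectedSolvable (H : Subgroup G) : Prop where
  closed : IsClosed[zariski K G] (H : Set G)
  connected : @IsConnected G (zariski K G) (H : Set G)
  solvable : Group.IsSolvable H

/-- Borel subgroups: the maximal closed connected solvable subgroups. -/
def IsBorelSubgroup (B : Subgroup G) : Prop :=
  Maximal (IsClosedConnectedSolvable K) B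

/-- A closed subgroup that is isomorphic, as an algebraic group, to some `(𝔾ₘ)ⁿ`. -/
structure IsTorus (T : Subgroup G) : Prop where
  closed : IsClosed[zariski K G] (T : Set G)
  exists_iso : ∃ (n : ℕ) (e : T ≃* (Fin n → Kˣ)), IsRegularMap K e ∧ IsRegularMap K e.symm

/-- Maximal tori of `G`. -/
def IsMaximalTorus (T : Subgroup G) : Prop :=
  Maximal (IsTorus K) T

theorem isRegularMap_units_iff {X : Type*} [RegularFunctions K X] (φ : X → Kˣ) :
    IsRegularMap K φ ↔ (fun x => (φ x : K)) ∈ coordRing K X ∧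
      (fun x => (((φ x)⁻¹ : Kˣ) : K)) ∈ coordRing K X := by
  constructor
  · intro h
    exact ⟨h _ (Algebra.subset_adjoin (Or.inl rfl)), h _ (Algebra.subset_adjoin (Or.inr rfl))⟩
  · rintro ⟨h1, h2⟩
    have : coordRing K Kˣ ≤ (coordRing K X).comap (pullback K φ) := by
      refine Algebra.adjoin_le ?_
      rintro f (rfl | rfl)
      · exact h1
      · exact h2
    exact fun f hf => this hf

/-- The character lattice `𝔛(H)`, written additively: all homomorphisms of algebraic groups
`H → 𝔾ₘ`. -/
def characterLattice (H : Type*) [Group H] [RegularFunctions K H] :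
    AddSubgroup (Additive (H →* Kˣ)) where
  carrier := {χ | IsRegularMap K χ.toMul}
  zero_mem' := by
    refine (isRegularMap_units_iff K _).2 ⟨?_, ?_⟩
    · exact one_mem (coordRing K H)
    · have : (fun x : H => ((((0 : Additive (H →* Kˣ)).toMul x)⁻¹ : Kˣ) : K)) = 1 := by
        funext x; simp
      rw [this]; exact one_mem _
  add_mem' := by
    intro a b ha hb
    have ha := (isRegularMap_units_iff K _).1 ha
    have hb := (isRegularMap_units_iff K _).1 hb
    refine (isRegularMap_units_iff K _).2 ⟨?_, ?_⟩
    · exact mul_mem ha.1 hb.1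
    · have : (fun x : H => ((((a + b).toMul x)⁻¹ : Kˣ) : K)) =
          (fun x => (((a.toMul x)⁻¹ : Kˣ) : K)) * (fun x => (((b.toMul x)⁻¹ : Kˣ) : K)) := by
        funext x; simp [mul_comm]
      rw [this]; exact mul_mem ha.2 hb.2
  neg_mem' := by
    intro a ha
    have ha := (isRegularMap_units_iff K _).1 ha
    refine (isRegularMap_units_iff K _).2 ⟨ha.2, ?_⟩
    have : (fun x : H => ((((-a).toMul x)⁻¹ : Kˣ) : K)) = fun x => (a.toMul x : K) := by
      funext x; simp
    rw [this]; exact ha.1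

/-- The value `χ(h) ∈ K` of a character. -/
def charValue {H : Type*} [Group H] [RegularFunctions K H] (χ : characterLattice K H) (h : H) :
    K :=
  ((χ.1.toMul h : Kˣ) : K)

/-- `α` is a root of `G` with respect to `T` that is positive with respect to `B`: a nonzero
character of `T` for which `B` contains a root subgroup, i.e. there is an embedding `u` of the
additive group into `G`, with image in `B`, such that `t u(s) t⁻¹ = u(α(t) s)`. -/
def IsPositiveRoot (B T : Subgroup G) (α : characterLattice K T) : Prop :=
  α ≠ 0 ∧ ∃ u : Multiplicative K →* G,
    IsRegularMap K (fun s : K => u (Multiplicative.ofAdd s)) ∧ Function.Injective u ∧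
    (∀ s, u s ∈ B) ∧
    ∀ (t : T) (s : K), (t : G) * u (Multiplicative.ofAdd s) * (t : G)⁻¹ =
      u (Multiplicative.ofAdd (charValue K α t * s))

end Groups

section Actions

variable (K : Type*) [Field K]

/-- The action map `G × X → X` is a morphism. -/
def IsRegularAction (G X : Type*) [Group G] [MulAction G X] [RegularFunctions K G]
    [RegularFunctions K X] : Prop :=
  IsRegularMap K (fun p : G × X => p.1 • p.2)

/-- The affine variety `X` is irreducible and normal. -/
structure IsIrreducibleNormal (X : Type*) [RegularFunctions K X] : Prop where
  irreducible : @IrreducibleSpace X (zariski K X)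
  normal : IsIntegrallyClosed (coordRing K X)

/-- `H` has a (Zariski) open orbit in `X`. -/
def HasOpenOrbit (H X : Type*) [Group H] [MulAction H X] [RegularFunctions K X] : Prop :=
  ∃ x : X, IsOpen[zariski K X] (MulAction.orbit H x)

/-- A toric `T`-variety: normal, irreducible, with an open `T`-orbit (the action need not be
effective). -/
def IsToric {G : Type*} [Group G] (T : Subgroup G) (X : Type*) [MulAction G X]
    [RegularFunctions K X] : Prop :=
  IsIrreducibleNormal K X ∧ HasOpenOrbit K T X

/-- A spherical `G`-variety: normal, irreducible, with an open orbit of the Borel subgroup `B`. -/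
def IsSpherical {G : Type*} [Group G] (B : Subgroup G) (X : Type*) [MulAction G X]
    [RegularFunctions K X] : Prop :=
  IsIrreducibleNormal K X ∧ HasOpenOrbit K B X

/-- The action of `G` on functions: `(g · f)(x) = f(g⁻¹ x)`. -/
def translate {G X : Type*} [Group G] [MulAction G X] (g : G) (f : X → K) : X → K :=
  fun x => f (g⁻¹ • x)

/-- A `G`-stable space of functions. -/
def IsStable (G : Type*) {X : Type*} [Group G] [MulAction G X] (V : Submodule K (X → K)) : Prop :=
  ∀ (g : G), ∀ f ∈ V, translate K g f ∈ V

/-- `V` is a simple `G`-submodule of `K[X]`. -/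
structure IsSimpleGSubmodule (G : Type*) {X : Type*} [Group G] [MulAction G X]
    [RegularFunctions K X] (V : Submodule K (X → K)) : Prop where
  le_coordRing : V ≤ Subalgebra.toSubmodule (coordRing K X)
  stable : IsStable K G V
  ne_bot : V ≠ ⊥
  eq_bot_or_eq : ∀ W : Submodule K (X → K), IsStable K G W → W ≤ V → W = ⊥ ∨ W = V

variable {G : Type*} [Group G] [RegularFunctions K G]

/-- `f` is a highest-weight vector (with respect to `B`) of weight `χ ∈ 𝔛(T)`: it is nonzero, its
line is `B`-stable, and `T` acts on it by `χ`. -/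
structure IsHighestWeightVector {X : Type*} [MulAction G X] (B T : Subgroup G)
    (χ : characterLattice K T) (f : X → K) : Prop where
  ne_zero : f ≠ 0
  line_stable : ∀ b ∈ B, ∃ c : K, translate K b f = c • f
  weight : ∀ t : T, translate K (t : G) f = charValue K χ t • f

/-- The weight monoid `Γ` of `X`: the weights `χ` such that `K[X]` contains a simple
`G`-submodule with highest weight `χ`. -/
def weightMonoid (B T : Subgroup G) (X : Type*) [MulAction G X] [RegularFunctions K X] :
    Set (characterLattice K T) :=
  {χ | ∃ V : Submodule K (X → K), IsSimpleGSubmodule K G V ∧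
    ∃ f ∈ V, IsHighestWeightVector K B T χ f}

/-- The subspace `ℚΓ` of `ℚ ⊗ 𝔛(T)`. -/
def weightSpan (B T : Subgroup G) (X : Type*) [MulAction G X] [RegularFunctions K X] :
    Submodule ℚ (ℚ ⊗[ℤ] characterLattice K T) :=
  Submodule.span ℚ ((fun χ => (1 : ℚ) ⊗ₜ[ℤ] χ) '' weightMonoid K B T X)

end Actions

end AffVar

/-!
The two conditions are linked by a third one: the weight spaces of `T` in `K[X]` have dimension at
most one. For an irreducible affine variety this holds if and only if `T` has an open orbit
(`exists_eq_smul_of_hasOpenOrbit`, `hasOpenOrbit_of_multiplicityFree`): in one direction, a weight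
vector vanishing at a point of the open orbit is zero; in the other, the points at which a finite
system of homogeneous generators of `K[X]` does not vanish form one orbit, since two of them differ
by a homomorphism from the group of weights to the divisible group `Kˣ`, which extends to `𝔛(T)`
and so is the evaluation at an element of `T`.

Suppose that `α` is not in `ℚΓ`, and let `f` and `g` be vectors of the same weight `χ`. Along the
unipotent radical `U` of `B` the translates of `f` form a polynomial curve, whose leading
coefficient is a highest-weight vector of weight `χ + m α`, where `m` is the degree. If the degrees
for `f` and `g` are different, a multiple of `α` is a difference of two elements of `Γ`. If they are
equal, the two leading coefficients are proportional since `B` has an open orbit, and a combination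
of `f` and `g` has smaller degree. So `f` and `g` are proportional (`multiplicityFree`).

Suppose that `m α = p - q` with `p` and `q` weights of products `F` and `F'` of highest-weight
vectors, and that `T` has an open orbit. Some highest-weight vector `v` has a weight that pairs
nontrivially with the coroot, and the simple module of `v` contains a vector `w₁` of weight lower by
`α`, which is not fixed by `U`. The functions `w₁ᵐ F` and `vᵐ F'` have the same weight, hence are
proportional, but only the second is `U`-invariant, a contradiction (`root_notMem_weightSpan`).

Both arguments use that a `B`-eigenvector generates a simple module. By `exists_binary_form`, its
orbit map is a binary form in the first column of a matrix of `SL₂`, on which everything is explicit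
(`mem_weightMonoid_of_uInvariant`).

The structure of `G` enters through `exists_adaptedCover`: the given cover of `G` by the product of
`SL₂` and a torus can be conjugated so that the upper unitriangular matrices map to the root
subgroup, the diagonal torus maps onto `T`, and `B` lies in the image of the upper triangular
matrices. For the first point, an element of the root subgroup is conjugate to its square and to its
cube, so its lift has trace `±2`; for the second, the image of a torus is a torus (`isTorus_range`)
and `T` is maximal; for the third, `SL₂` is perfect and `B` is solvable.
-/

namespace AffVar

/-! ### Regular maps and characters -/

section RegularMaps

variable {K : Type*} [Field K] {X Y Z : Type*} [RegularFunctions K X] [RegularFunctions K Y]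
  [RegularFunctions K Z]

omit [RegularFunctions K X] [RegularFunctions K Y] in
@[simp] theorem pullback_apply (φ : X → Y) (f : Y → K) (x : X) :
    pullback K φ f x = f (φ x) := rfl

theorem IsRegularMap.comp {φ : X → Y} {ψ : Y → Z} (hψ : IsRegularMap K ψ)
    (hφ : IsRegularMap K φ) : IsRegularMap K (fun x => ψ (φ x)) :=
  fun f hf => hφ _ (hψ f hf)

theorem isRegularMap_iff_le {φ : X → Y} :
    IsRegularMap K φ ↔ coordRing K Y ≤ (coordRing K X).comap (pullback K φ) :=
  Iff.rfl

theorem isRegularMap_const (y : Y) : IsRegularMap K (fun _ : X => y) :=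
  fun f _ => (coordRing K X).algebraMap_mem (f y)

theorem isRegularMap_fst : IsRegularMap K (Prod.fst : X × Y → X) :=
  fun f hf => (le_sup_left : (coordRing K X).map (pullback K Prod.fst) ≤ coordRing K (X × Y))
    ⟨f, hf, rfl⟩

theorem isRegularMap_snd : IsRegularMap K (Prod.snd : X × Y → Y) :=
  fun f hf => (le_sup_right : (coordRing K Y).map (pullback K Prod.snd) ≤ coordRing K (X × Y))
    ⟨f, hf, rfl⟩

theorem IsRegularMap.prodMk {φ : X → Y} {ψ : X → Z} (hφ : IsRegularMap K φ)
    (hψ : IsRegularMap K ψ) : IsRegularMap K (fun x => (φ x, ψ x)) := by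
  rw [isRegularMap_iff_le]
  refine sup_le ?_ ?_
  · rintro _ ⟨f, hf, rfl⟩
    exact hφ f hf
  · rintro _ ⟨f, hf, rfl⟩
    exact hψ f hf

theorem isRegularMap_eval {n : ℕ} (i : Fin n) : IsRegularMap K (fun x : Fin n → X => x i) :=
  fun f hf => (le_iSup (fun i : Fin n =>
    (coordRing K X).map (pullback K fun x : Fin n → X => x i)) i) ⟨f, hf, rfl⟩

theorem isRegularMap_pi {n : ℕ} {φ : X → Fin n → Y} (h : ∀ i, IsRegularMap K (fun x => φ x i)) :
    IsRegularMap K φ := by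
  rw [isRegularMap_iff_le]
  refine iSup_le fun i => ?_
  rintro _ ⟨f, hf, rfl⟩
  exact h i f hf

theorem isRegularMap_val (p : X → Prop) : IsRegularMap K (Subtype.val : Subtype p → X) :=
  fun f hf => ⟨f, hf, rfl⟩

theorem isRegularMap_subtype {p : Y → Prop} {φ : X → Subtype p}
    (h : IsRegularMap K (fun x => (φ x : Y))) : IsRegularMap K φ := by
  rintro _ ⟨f, hf, rfl⟩
  exact h f hf

theorem isRegularMap_sl2_iff {φ : X → Matrix.SpecialLinearGroup (Fin 2) K} :
    IsRegularMap K φ ↔ ∀ i j, (fun x => (φ x).1 i j) ∈ coordRing K X := by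
  constructor
  · exact fun h i j => h _ (Algebra.subset_adjoin ⟨(i, j), rfl⟩)
  · intro h
    rw [isRegularMap_iff_le]
    refine Algebra.adjoin_le ?_
    rintro _ ⟨⟨i, j⟩, rfl⟩
    exact h i j

theorem mem_coordRing_sl2 (i j : Fin 2) :
    (fun A : Matrix.SpecialLinearGroup (Fin 2) K => A.1 i j) ∈ coordRing K _ :=
  Algebra.subset_adjoin ⟨(i, j), rfl⟩

theorem id_mem_coordRing_affineLine : (fun s : K => s) ∈ coordRing K K :=
  Algebra.subset_adjoin rfl

theorem exists_polynomial_of_mem_coordRing_affineLine {f : K → K} (hf : f ∈ coordRing K K) :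
    ∃ p : Polynomial K, ∀ s, f s = p.eval s := by
  refine Algebra.adjoin_induction (p := fun f _ => ∃ p : Polynomial K, ∀ s, f s = p.eval s)
    ?_ ?_ ?_ ?_ hf
  · rintro _ rfl
    exact ⟨Polynomial.X, by simp⟩
  · exact fun r => ⟨Polynomial.C r, by simp⟩
  · rintro f g _ _ ⟨p, hp⟩ ⟨q, hq⟩
    exact ⟨p + q, by simp [hp, hq]⟩
  · rintro f g _ _ ⟨p, hp⟩ ⟨q, hq⟩
    exact ⟨p * q, by simp [hp, hq]⟩

/-- A regular function on a product is a finite sum of products of regular functions. -/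
theorem exists_sum_mul_of_mem_coordRing_prod {f : X × Y → K} (hf : f ∈ coordRing K (X × Y)) :
    ∃ (n : ℕ) (a : Fin n → X → K) (b : Fin n → Y → K), (∀ i, a i ∈ coordRing K X) ∧
      (∀ i, b i ∈ coordRing K Y) ∧ ∀ x y, f (x, y) = ∑ i, a i x * b i y := by
  have key : f ∈ (Subalgebra.toSubmodule ((coordRing K X).map (pullback K Prod.fst))) *
      (Subalgebra.toSubmodule ((coordRing K Y).map (pullback K (Prod.snd : X × Y → Y)))) := by
    rw [Subalgebra.mul_toSubmodule]
    exact hf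
  refine Submodule.mul_induction_on (C := fun f : X × Y → K => ∃ (n : ℕ) (a : Fin n → X → K)
    (b : Fin n → Y → K), (∀ i, a i ∈ coordRing K X) ∧ (∀ i, b i ∈ coordRing K Y) ∧
    ∀ x y, f (x, y) = ∑ i, a i x * b i y) key ?_ ?_
  · rintro _ ⟨a, ha, rfl⟩ _ ⟨b, hb, rfl⟩
    exact ⟨1, fun _ => a, fun _ => b, fun _ => ha, fun _ => hb, fun x y => by simp⟩
  · rintro f g ⟨n, a, b, ha, hb, h⟩ ⟨m, a', b', ha', hb', h'⟩
    refine ⟨n + m, Fin.append a a', Fin.append b b', ?_, ?_, ?_⟩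
    · intro i; refine Fin.addCases (fun i => ?_) (fun i => ?_) i <;> simp [ha, ha']
    · intro i; refine Fin.addCases (fun i => ?_) (fun i => ?_) i <;> simp [hb, hb']
    · intro x y; simp [Fin.sum_univ_add, h, h']

end RegularMaps

section Characters

variable {K : Type*} [Field K]

/-- Independence of characters with vector-valued coefficients, modulo a subspace. -/
theorem mem_of_forall_sum_hom_smul_mem {M V ι : Type*} [Monoid M] [AddCommGroup V] [Module K V]
    (W : Submodule K V) (s : Finset ι) (χ : ι → M →* K) (hχ : Set.InjOn χ s) (v : ι → V)
    (h : ∀ m, ∑ i ∈ s, χ i m • v i ∈ W) : ∀ i ∈ s, v i ∈ W := by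
  intro i hi
  by_contra hvi
  obtain ⟨l, hl, hlW⟩ := Submodule.exists_le_ker_of_notMem hvi
  have hli := (linearIndependent_monoidHom M K).comp (fun i : s => χ i.1)
    (fun a b hab => Subtype.ext (hχ a.2 b.2 hab))
  rw [Fintype.linearIndependent_iff] at hli
  refine hl (hli (fun i => l (v i.1)) ?_ ⟨i, hi⟩)
  funext m
  have := hlW (h m)
  rw [LinearMap.mem_ker, map_sum] at this
  rw [← Finset.sum_coe_sort] at this
  simpa [mul_comm] using this

/-- If a polynomial curve lies in a subspace, so do its coefficients. -/
theorem mem_of_forall_sum_pow_smul_mem [Infinite K] {V : Type*} [AddCommGroup V] [Module K V]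
    (W : Submodule K V) (N : ℕ) (v : ℕ → V)
    (h : ∀ s : K, ∑ i ∈ Finset.range N, s ^ i • v i ∈ W) : ∀ i < N, v i ∈ W := by
  intro i hi
  refine mem_of_forall_sum_hom_smul_mem (M := K) W (Finset.range N) (fun i => powMonoidHom i) ?_ v
    (fun s => by simpa using h s) i (by simpa using hi)
  intro a _ b _ hab
  have : (Polynomial.X ^ a : Polynomial K) = Polynomial.X ^ b :=
    Polynomial.funext fun s => by simpa using DFunLike.congr_fun hab s
  simpa using congrArg Polynomial.natDegree this

variable {H : Type*} [Group H] [RegularFunctions K H]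

/-- The character `χ` as a homomorphism to the multiplicative monoid of `K`. -/
def charHom (χ : characterLattice K H) : H →* K := (Units.coeHom K).comp χ.1.toMul

@[simp] theorem charHom_apply (χ : characterLattice K H) (h : H) :
    charHom χ h = charValue K χ h := rfl

theorem charHom_injective : Function.Injective (charHom : characterLattice K H → H →* K) := by
  intro χ ψ h
  apply Subtype.ext
  apply Additive.toMul.injective
  ext x
  exact DFunLike.congr_fun h x

theorem charValue_mul (χ : characterLattice K H) (g h : H) :
    charValue K χ (g * h) = charValue K χ g * charValue K χ h := map_mul (charHom χ) g h

theorem charValue_add (χ ψ : characterLattice K H) (h : H) :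
    charValue K (χ + ψ) h = charValue K χ h * charValue K ψ h := rfl

@[simp] theorem charValue_zero (h : H) : charValue K (0 : characterLattice K H) h = 1 := rfl

theorem charValue_ne_zero (χ : characterLattice K H) (h : H) : charValue K χ h ≠ 0 :=
  Units.ne_zero _

theorem charValue_nsmul (n : ℕ) (χ : characterLattice K H) (h : H) :
    charValue K (n • χ) h = charValue K χ h ^ n := by
  induction n with
  | zero => simp
  | succ n ih => rw [succ_nsmul, charValue_add, ih, pow_succ]

theorem charValue_neg (χ : characterLattice K H) (h : H) :
    charValue K (-χ) h = (charValue K χ h)⁻¹ := by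
  refine eq_inv_of_mul_eq_one_left ?_
  rw [← charValue_add]; simp

theorem charValue_zsmul (n : ℤ) (χ : characterLattice K H) (h : H) :
    charValue K (n • χ) h = charValue K χ h ^ n := by
  cases n with
  | ofNat n => simpa using charValue_nsmul n χ h
  | negSucc n => simp [negSucc_zsmul, charValue_neg, charValue_nsmul, -nsmul_eq_mul]

theorem charValue_ext {χ ψ : characterLattice K H}
    (h : ∀ x, charValue K χ x = charValue K ψ x) : χ = ψ :=
  charHom_injective (MonoidHom.ext h)

theorem charValue_mem_coordRing (χ : characterLattice K H) : charValue K χ ∈ coordRing K H :=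
  ((isRegularMap_units_iff K _).1 χ.2).1

/-- The pullback of characters along a homomorphism of algebraic groups. -/
def charPullback {H' : Type*} [Group H'] [RegularFunctions K H'] (φ : H' →* H)
    (hφ : IsRegularMap K φ) : characterLattice K H →+ characterLattice K H' where
  toFun χ := ⟨Additive.ofMul (χ.1.toMul.comp φ), IsRegularMap.comp (ψ := χ.1.toMul) χ.2 hφ⟩
  map_zero' := rfl
  map_add' _ _ := rfl

@[simp] theorem charValue_charPullback {H' : Type*} [Group H'] [RegularFunctions K H']
    (φ : H' →* H) (hφ : IsRegularMap K φ) (χ : characterLattice K H) (h : H') :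
    charValue K (charPullback φ hφ χ) h = charValue K χ (φ h) := rfl

variable (K H) in
/-- The group `H` is diagonalizable: its regular functions are spanned by characters. -/
def IsDiagonalizable : Prop :=
  ∀ f ∈ coordRing K H, f ∈ Submodule.span K (Set.range (charValue K : _ → H → K))

variable (K H) in
/-- Every homomorphism `𝔛(H) → Kˣ` is the evaluation at a point of `H`. -/
def SeparatesDual : Prop :=
  ∀ θ : characterLattice K H →+ Additive Kˣ, ∃ t : H, ∀ χ, charValue K χ t = ((θ χ).toMul : Kˣ)

theorem IsDiagonalizable.exists_sum (hH : IsDiagonalizable K H) {f : H → K}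
    (hf : f ∈ coordRing K H) : ∃ c : characterLattice K H →₀ K,
      ∀ h, f h = ∑ χ ∈ c.support, c χ * charValue K χ h := by
  obtain ⟨c, hc⟩ := Finsupp.mem_span_range_iff_exists_finsupp.1 (hH f hf)
  refine ⟨c, fun h => ?_⟩
  rw [← hc, Finsupp.sum, Finset.sum_apply]
  rfl

omit [RegularFunctions K H] in
/-- On a diagonalizable group, a spanning set of regular functions consisting of characters
already contains all characters. -/
theorem mem_range_of_mem_span_charHom {ι : Type*} (m : ι → H →* K) (χ : H →* K)
    (hχ : (χ : H → K) ∈ Submodule.span K (Set.range fun i => (m i : H → K))) : ∃ i, m i = χ := by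
  by_contra! hne
  have hli := linearIndependent_monoidHom H K
  have := hli.notMem_span_image (s := Set.range m) (x := χ) (by rintro ⟨i, hi⟩; exact hne i hi)
  rw [← Set.range_comp] at this
  exact this hχ

end Characters

/-! ### Tori -/

section Tori

variable {K : Type*} [Field K]

/-- The `i`-th coordinate character of the torus `(𝔾ₘ)ᵐ`. -/
def coordChar (K : Type*) [Field K] {m : ℕ} (i : Fin m) : characterLattice K (Fin m → Kˣ) :=
  ⟨Additive.ofMul (Pi.evalMonoidHom _ i), isRegularMap_eval i⟩

@[simp] theorem charValue_coordChar {m : ℕ} (i : Fin m) (x : Fin m → Kˣ) :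
    charValue K (coordChar K i) x = x i := rfl

/-- The regular functions on a torus are spanned by the Laurent monomials. -/
theorem mem_span_monomials {m : ℕ} {f : (Fin m → Kˣ) → K} (hf : f ∈ coordRing K (Fin m → Kˣ)) :
    f ∈ Submodule.span K
      (Set.range fun χ : AddSubgroup.closure (Set.range (coordChar K (m := m))) =>
      charValue K χ.1) := by
  set L := AddSubgroup.closure (Set.range (coordChar K (m := m)))
  let S : Submonoid ((Fin m → Kˣ) → K) :=
    { carrier := Set.range fun χ : L => charValue K χ.1
      one_mem' := ⟨0, rfl⟩
      mul_mem' := by rintro _ _ ⟨χ, rfl⟩ ⟨ψ, rfl⟩; exact ⟨χ + ψ, rfl⟩ }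
  have hle : coordRing K (Fin m → Kˣ) ≤ Algebra.adjoin K (S : Set ((Fin m → Kˣ) → K)) := by
    refine iSup_le fun i => ?_
    rw [Subalgebra.map_le]
    refine Algebra.adjoin_le ?_
    have hi : coordChar K i ∈ L := AddSubgroup.subset_closure ⟨i, rfl⟩
    rintro _ (rfl | rfl)
    · exact Algebra.subset_adjoin ⟨⟨_, hi⟩, rfl⟩
    · refine Algebra.subset_adjoin ⟨⟨_, neg_mem hi⟩, ?_⟩
      rfl
  have := hle hf
  rw [← Subalgebra.mem_toSubmodule, Algebra.adjoin_eq_span, Submonoid.closure_eq] at this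
  exact this

theorem closure_coordChar {m : ℕ} :
    AddSubgroup.closure (Set.range (coordChar K (m := m))) = ⊤ := by
  refine eq_top_iff.2 fun χ _ => ?_
  obtain ⟨ψ, hψ⟩ := mem_range_of_mem_span_charHom
    (fun ψ : AddSubgroup.closure (Set.range (coordChar K (m := m))) => charHom ψ.1)
    (charHom χ) (mem_span_monomials (charValue_mem_coordRing χ))
  rw [← charHom_injective hψ]
  exact ψ.2

theorem isDiagonalizable_torus (m : ℕ) : IsDiagonalizable K (Fin m → Kˣ) := fun f hf =>
  Submodule.span_mono (by rintro _ ⟨χ, rfl⟩; exact ⟨_, rfl⟩) (mem_span_monomials hf)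

theorem separatesDual_torus (m : ℕ) : SeparatesDual K (Fin m → Kˣ) := by
  intro θ
  refine ⟨fun i => (θ (coordChar K i)).toMul, fun χ => ?_⟩
  have hχ : χ ∈ AddSubgroup.closure (Set.range (coordChar K (m := m))) := by
    rw [closure_coordChar]; trivial
  induction hχ using AddSubgroup.closure_induction with
  | mem x hx => obtain ⟨i, rfl⟩ := hx; rfl
  | zero => simp
  | add x y _ _ hx hy => rw [charValue_add, hx, hy]; simp
  | neg x _ hx => rw [charValue_neg, hx]; simp

section Transport

variable {H H' : Type*} [Group H] [RegularFunctions K H] [Group H'] [RegularFunctions K H']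

theorem IsDiagonalizable.of_mulEquiv (e : H ≃* H') (he : IsRegularMap K e)
    (he' : IsRegularMap K e.symm) (h : IsDiagonalizable K H') : IsDiagonalizable K H := by
  intro f hf
  have h1 := h _ (he' f hf)
  have h2 := Submodule.mem_map_of_mem (f := (pullback K e).toLinearMap) h1
  rw [Submodule.map_span] at h2
  have h3 : (pullback K e).toLinearMap (pullback K e.symm f) = f := by
    funext x; simp
  rw [h3] at h2
  refine Submodule.span_mono ?_ h2
  rintro _ ⟨_, ⟨χ, rfl⟩, rfl⟩
  exact ⟨charPullback e.toMonoidHom he χ, rfl⟩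

theorem SeparatesDual.of_mulEquiv (e : H ≃* H') (he : IsRegularMap K e)
    (he' : IsRegularMap K e.symm) (h : SeparatesDual K H') : SeparatesDual K H := by
  intro θ
  obtain ⟨t, ht⟩ := h (θ.comp (charPullback e.toMonoidHom he))
  refine ⟨e.symm t, fun χ => ?_⟩
  have := ht (charPullback e.symm.toMonoidHom he' χ)
  change charValue K χ (e.symm t) = _ at this
  rw [this]
  have : (charPullback e.toMonoidHom he) (charPullback e.symm.toMonoidHom he' χ) = χ := by
    refine charValue_ext fun x => ?_
    simp
  rw [AddMonoidHom.comp_apply, this]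

end Transport

variable {G : Type*} [Group G] [RegularFunctions K G]

theorem IsTorus.isDiagonalizable {T : Subgroup G} (hT : IsTorus K T) : IsDiagonalizable K T := by
  obtain ⟨n, e, he, he'⟩ := hT.exists_iso
  exact (isDiagonalizable_torus n).of_mulEquiv e he he'

theorem IsTorus.separatesDual {T : Subgroup G} (hT : IsTorus K T) : SeparatesDual K T := by
  obtain ⟨n, e, he, he'⟩ := hT.exists_iso
  exact (separatesDual_torus n).of_mulEquiv e he he'

variable [IsAlgClosed K]

theorem units_exists_pow_eq (a : Kˣ) {n : ℕ} (hn : n ≠ 0) : ∃ b : Kˣ, b ^ n = a := by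
  obtain ⟨z, hz⟩ := IsAlgClosed.exists_pow_nat_eq (a : K) (Nat.pos_of_ne_zero hn)
  have hz0 : z ≠ 0 := by
    rintro rfl
    rw [zero_pow hn] at hz
    exact a.ne_zero hz.symm
  exact ⟨Units.mk0 z hz0, Units.ext (by simpa using hz)⟩

theorem units_exists_zpow_eq (a : Kˣ) {n : ℤ} (hn : n ≠ 0) : ∃ b : Kˣ, b ^ n = a := by
  obtain ⟨b, hb⟩ := units_exists_pow_eq a (Int.natAbs_ne_zero.2 hn)
  rcases Int.natAbs_eq n with h | h
  · exact ⟨b, by rw [h, zpow_natCast, hb]⟩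
  · exact ⟨b⁻¹, by rw [h, inv_zpow, zpow_neg, inv_inv, zpow_natCast, hb]⟩

/-- Homomorphisms to the divisible group `Kˣ` extend from subgroups: a homomorphism
`β : M → Kˣ` that is trivial on the kernel of `j : M → N` factors through `j`. -/
theorem exists_extension_units {M N : Type*} [AddCommGroup M] [AddCommGroup N] (j : M →+ N)
    (β : M →+ Additive Kˣ) (h : ∀ m, j m = 0 → β m = 0) :
    ∃ θ : N →+ Additive Kˣ, ∀ m, θ (j m) = β m := by
  let : DivisibleBy (Additive Kˣ) ℤ := divisibleByOfSMulRightSurj _ _ fun {n} hn x => by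
    obtain ⟨b, hb⟩ := units_exists_zpow_eq x.toMul hn
    exact ⟨Additive.ofMul b, congrArg Additive.ofMul hb⟩
  have hker : j.ker ≤ β.ker := fun m hm => h m hm
  let j' := QuotientAddGroup.kerLift j
  let β' := QuotientAddGroup.lift j.ker β hker
  obtain ⟨θ, hθ⟩ := (Module.Baer.of_divisible (Additive Kˣ)).extension_property_addMonoidHom
    j' (QuotientAddGroup.kerLift_injective j) β'
  refine ⟨θ, fun m => ?_⟩
  exact DFunLike.congr_fun hθ (m : M ⧸ j.ker)

theorem SeparatesDual.charValue_surjective {H : Type*} [Group H] [RegularFunctions K H]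
    (hH : SeparatesDual K H) (hfree : ∀ (χ : characterLattice K H) (n : ℤ), n • χ = 0 →
      χ = 0 ∨ n = 0) {χ : characterLattice K H} (hχ : χ ≠ 0) {a : K} (ha : a ≠ 0) :
    ∃ t, charValue K χ t = a := by
  obtain ⟨θ, hθ⟩ := exists_extension_units (K := K) (zmultiplesHom _ χ)
    (zmultiplesHom _ (Additive.ofMul (Units.mk0 a ha))) (by
      intro n hn
      rcases hfree χ n (by simpa using hn) with h | h
      · exact absurd h hχ
      · simp [h])
  obtain ⟨t, ht⟩ := hH θ
  refine ⟨t, ?_⟩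
  rw [ht]
  have := hθ 1
  simp at this
  simp [this]

omit [IsAlgClosed K] in
/-- The character lattice of a divisible group is torsion-free. -/
theorem eq_zero_or_of_zsmul_eq_zero {H : Type*} [Group H] [RegularFunctions K H]
    (hdiv : ∀ (x : H) (n : ℤ), n ≠ 0 → ∃ y, y ^ n = x) (χ : characterLattice K H) (n : ℤ)
    (h : n • χ = 0) : χ = 0 ∨ n = 0 := by
  by_contra! hne
  refine hne.1 (charValue_ext fun x => ?_)
  obtain ⟨y, rfl⟩ := hdiv x n hne.2
  have h1 : charValue K χ (y ^ n) = charValue K χ y ^ n := by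
    simp [charValue]
  rw [h1, ← charValue_zsmul, h]
  rfl

theorem torus_divisible {m : ℕ} (x : Fin m → Kˣ) (n : ℤ) (hn : n ≠ 0) : ∃ y, y ^ n = x := by
  choose y hy using fun i => units_exists_zpow_eq (x i) hn
  exact ⟨y, funext hy⟩

theorem IsTorus.divisible {T : Subgroup G} (hT : IsTorus K T) (x : T) (n : ℤ) (hn : n ≠ 0) :
    ∃ y, y ^ n = x := by
  obtain ⟨m, e, -, -⟩ := hT.exists_iso
  obtain ⟨y, hy⟩ := torus_divisible (e x) n hn
  exact ⟨e.symm y, by rw [← map_zpow, hy, e.symm_apply_apply]⟩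

theorem IsTorus.charValue_surjective {T : Subgroup G} (hT : IsTorus K T)
    {χ : characterLattice K T} (hχ : χ ≠ 0) {a : K} (ha : a ≠ 0) : ∃ t, charValue K χ t = a :=
  hT.separatesDual.charValue_surjective (eq_zero_or_of_zsmul_eq_zero hT.divisible) hχ ha

end Tori

/-! ### Images of tori are tori -/

section ImageTorus

variable {K : Type*} [Field K]

theorem IsAffineVariety.ext {X : Type*} [RegularFunctions K X] (hX : IsAffineVariety K X) {x y : X}
    (h : ∀ f ∈ coordRing K X, f x = f y) : x = y :=
  hX.eval_bijective.1 (AlgHom.ext fun f => h f.1 f.2)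

theorem isOpen_ne_zero {X : Type*} [RegularFunctions K X] {f : X → K} (hf : f ∈ coordRing K X) :
    IsOpen[zariski K X] {x | f x ≠ 0} :=
  TopologicalSpace.isOpen_generateFrom_of_mem ⟨f, hf, rfl⟩

theorem isClosed_of_separated {X : Type*} [RegularFunctions K X] {S : Set X}
    (h : ∀ x, (∀ f ∈ coordRing K X, (∀ y ∈ S, f y = 0) → f x = 0) → x ∈ S) :
    IsClosed[zariski K X] S := by
  let _ := zariski K X
  rw [← isOpen_compl_iff, isOpen_iff_mem_nhds]
  intro x hx
  have : ∃ f ∈ coordRing K X, (∀ y ∈ S, f y = 0) ∧ f x ≠ 0 := by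
    by_contra! hc
    exact hx (h x hc)
  obtain ⟨f, hf, hfS, hfx⟩ := this
  exact Filter.mem_of_superset ((isOpen_ne_zero hf).mem_nhds hfx) fun y hy hyS => hy (hfS y hyS)

variable {G : Type*} [Group G] [RegularFunctions K G]

theorem IsLinearAlgebraicGroup.mul_left_mem (hG : IsLinearAlgebraicGroup K G) {f : G → K}
    (hf : f ∈ coordRing K G) (g : G) : (fun h => f (g * h)) ∈ coordRing K G :=
  ((hG.mul_regular.comp ((isRegularMap_const g).prodMk fun _ h => h)) f hf :)

theorem IsLinearAlgebraicGroup.inv_mem (hG : IsLinearAlgebraicGroup K G) {f : G → K}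
    (hf : f ∈ coordRing K G) : (fun g => f g⁻¹) ∈ coordRing K G :=
  hG.inv_regular f hf

variable {H : Type*} [CommGroup H] [RegularFunctions K H]

/-- The characters of `H` that are restrictions along `ψ` of regular functions on `G`; these are
the characters of the image of `ψ`. -/
def imageCharacters (hG : IsLinearAlgebraicGroup K G) (ψ : H →* G) :
    Submodule ℤ (characterLattice K H) := AddSubgroup.toIntSubmodule
  (M := characterLattice K H) {
  carrier := {χ | ∃ A ∈ coordRing K G, ∀ x, A (ψ x) = charValue K χ x}
  zero_mem' := ⟨1, one_mem _, fun _ => rfl⟩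
  add_mem' := by
    rintro χ χ' ⟨A, hA, h⟩ ⟨A', hA', h'⟩
    exact ⟨A * A', mul_mem hA hA', fun x => by simp [h, h', charValue_add]⟩
  neg_mem' := by
    rintro χ ⟨A, hA, h⟩
    refine ⟨_, hG.inv_mem hA, fun x => ?_⟩
    rw [← map_inv, h, charValue_neg]
    simp [charValue] }

theorem exists_sum_imageCharacters (hG : IsLinearAlgebraicGroup K G) {ψ : H →* G}
    (hψ : IsRegularMap K ψ) (hH : IsDiagonalizable K H) {f : G → K} (hf : f ∈ coordRing K G) :
    ∃ c : characterLattice K H →₀ K, (∀ χ ∈ c.support, χ ∈ imageCharacters hG ψ) ∧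
      ∀ x, f (ψ x) = ∑ χ ∈ c.support, c χ * charValue K χ x := by
  obtain ⟨c, hc⟩ := hH.exists_sum (hψ f hf)
  refine ⟨c, fun χ hχ => ?_, hc⟩
  let W : Submodule K (H → K) :=
    (Subalgebra.toSubmodule (coordRing K G)).map (pullback K ψ).toLinearMap
  have hmem := mem_of_forall_sum_hom_smul_mem W c.support charHom charHom_injective.injOn
    (fun χ => c χ • charValue K χ) (by
      intro y
      refine ⟨_, hG.mul_left_mem hf (ψ y), ?_⟩
      funext x
      change f (ψ y * ψ x) = _
      rw [← map_mul]
      refine (hc (y * x)).trans ?_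
      rw [Finset.sum_apply]
      refine Finset.sum_congr rfl fun χ _ => ?_
      simp [charValue_mul]
      ring) χ hχ
  have h0 : c χ ≠ 0 := by simpa using hχ
  obtain ⟨A, hA, h⟩ := (Submodule.smul_mem_iff W h0).1 hmem
  exact ⟨A, hA, fun x => congrFun h x⟩

variable [IsAlgClosed K]

theorem isClosed_range_of_diagonalizable (hG : IsLinearAlgebraicGroup K G) {ψ : H →* G}
    (hψ : IsRegularMap K ψ) (hH : IsDiagonalizable K H) (hH' : SeparatesDual K H) :
    IsClosed[zariski K G] (ψ.range : Set G) := by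
  refine isClosed_of_separated fun g hg => ?_
  have hgx : ∀ A ∈ coordRing K G, ∀ A' ∈ coordRing K G, (∀ x, A (ψ x) = A' (ψ x)) →
      A g = A' g := by
    intro A hA A' hA' h
    have := hg (A - A') (sub_mem hA hA') (by rintro _ ⟨x, rfl⟩; simp [h])
    simpa [sub_eq_zero] using this
  choose A hA hAx using fun χ : imageCharacters hG ψ => χ.2
  have hmul : ∀ χ χ', A (χ + χ') g = A χ g * A χ' g := fun χ χ' =>
    hgx _ (hA _) _ (mul_mem (hA χ) (hA χ')) fun x => by
      simp [hAx, charValue_add]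
  have hzero : A 0 g = 1 := hgx _ (hA _) _ (one_mem _) fun x => by simp [hAx]
  let β : imageCharacters hG ψ →+ Additive Kˣ := MonoidHom.toAdditiveRight
    (MonoidHom.toHomUnits (G := Multiplicative (imageCharacters hG ψ)) (M := K)
      { toFun := fun χ => A χ.toAdd g
        map_one' := hzero
        map_mul' := fun χ χ' => hmul _ _ })
  obtain ⟨θ, hθ⟩ := exists_extension_units (K := K) (imageCharacters hG ψ).subtype.toAddMonoidHom β (by
    intro χ hχ
    have : χ = 0 := Subtype.ext hχ
    rw [this, map_zero])
  obtain ⟨x, hx⟩ := hH' θ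
  refine ⟨x, (hG.isAffineVariety.ext fun f hf => ?_)⟩
  obtain ⟨c, hc, hcf⟩ := exists_sum_imageCharacters hG hψ hH hf
  have hfg : f g = (∑ χ ∈ c.support.attach, c χ.1 • A ⟨χ.1, hc _ χ.2⟩) g := by
    refine hgx f hf _ (sum_mem fun χ _ => Subalgebra.smul_mem _ (hA _) _) fun y => ?_
    rw [hcf, ← Finset.sum_attach, Finset.sum_apply]
    exact Finset.sum_congr rfl fun χ _ => by simp [hAx]
  rw [hfg, hcf, ← Finset.sum_attach, Finset.sum_apply]
  refine Finset.sum_congr rfl fun χ _ => ?_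
  have := hθ ⟨χ.1, hc _ χ.2⟩
  rw [hx, show θ χ.1 = _ from this]
  rfl

/-- The image of a torus under a homomorphism of algebraic groups is a torus. -/
theorem isTorus_range (hG : IsLinearAlgebraicGroup K G) {m : ℕ} {ψ : (Fin m → Kˣ) →* G}
    (hψ : IsRegularMap K ψ) : IsTorus K ψ.range := by
  have hH := isDiagonalizable_torus (K := K) m
  have hH' := separatesDual_torus (K := K) m
  refine ⟨isClosed_range_of_diagonalizable hG hψ hH hH', ?_⟩
  have : AddGroup.FG (characterLattice K (Fin m → Kˣ)) :=
    (AddGroup.fg_iff).2 ⟨_, closure_coordChar, Set.finite_range _⟩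
  have : Module.Finite ℤ (characterLattice K (Fin m → Kˣ)) := Module.Finite.iff_addGroup_fg.2 this
  have : Module.IsTorsionFree ℤ (characterLattice K (Fin m → Kˣ)) := by
    refine Module.isTorsionFree_iff_smul_eq_zero.2 fun n χ h => ?_
    exact (eq_zero_or_of_zsmul_eq_zero torus_divisible χ n h).symm
  let L := imageCharacters hG ψ
  have hfree : Module.Free ℤ L := inferInstance
  have hfin : Module.Finite ℤ L := inferInstance
  let b := Module.finBasis ℤ L
  set r := Module.finrank ℤ L
  -- the homomorphism given by a basis of the character lattice of the image
  let q : (Fin m → Kˣ) →* (Fin r → Kˣ) := MonoidHom.pi fun j => (b j).1.1.toMul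
  have hq : IsRegularMap K q := isRegularMap_pi fun j => (b j).1.2
  let κ : L →ₗ[ℤ] characterLattice K (Fin r → Kˣ) := b.constr ℤ fun j => coordChar K j
  have hκ : (charPullback q hq).toIntLinearMap ∘ₗ κ = L.subtype := by
    refine b.ext fun j => ?_
    simp only [LinearMap.comp_apply, κ, Module.Basis.constr_basis]
    rfl
  have hκx : ∀ (χ : L) x, charValue K χ.1 x = charValue K (κ χ) (q x) := fun χ x => by
    conv_lhs => rw [show χ.1 = L.subtype χ from rfl, ← hκ]
    rfl
  have hsum : ∀ f ∈ coordRing K G, ∃ R ∈ coordRing K (Fin r → Kˣ), ∀ x, f (ψ x) = R (q x) := by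
    intro f hf
    obtain ⟨c, hc, hcf⟩ := exists_sum_imageCharacters hG hψ hH hf
    refine ⟨∑ χ ∈ c.support.attach, c χ.1 • charValue K (κ ⟨χ.1, hc _ χ.2⟩),
      sum_mem fun χ _ => Subalgebra.smul_mem _ (charValue_mem_coordRing _) _, fun x => ?_⟩
    rw [hcf, ← Finset.sum_attach, Finset.sum_apply]
    exact Finset.sum_congr rfl fun χ _ => by
      rw [hκx ⟨χ.1, hc _ χ.2⟩ x]
      rfl
  have hker : ∀ x, q x = 1 → ψ x = 1 := by
    intro x hx
    refine hG.isAffineVariety.ext fun f hf => ?_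
    obtain ⟨R, -, hR⟩ := hsum f hf
    rw [hR, hx, ← map_one q, ← hR, map_one]
  have hker' : ∀ x, ψ x = 1 → q x = 1 := by
    intro x hx
    funext j
    obtain ⟨A, -, hA⟩ := (b j).2
    have h1 := hA x
    rw [hx, ← map_one ψ, hA] at h1
    exact Units.ext (h1.symm.trans (by simp [charValue]))
  have hsurj : Function.Surjective q := by
    intro c
    obtain ⟨θ, hθ⟩ := exists_extension_units (K := K) L.subtype.toAddMonoidHom
      (b.constr ℤ fun j => Additive.ofMul (c j)).toAddMonoidHom (by
        intro χ hχ
        have : χ = 0 := Subtype.ext hχ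
        rw [this, map_zero])
    obtain ⟨x, hx⟩ := hH' θ
    refine ⟨x, funext fun j => Units.ext ?_⟩
    refine (hx (b j).1).trans ?_
    have := hθ (b j)
    simp only [LinearMap.toAddMonoidHom_coe, Module.Basis.constr_basis] at this
    rw [show θ (b j).1 = _ from this]
    rfl
  have hkereq : ψ.rangeRestrict.ker = q.ker := by
    ext x
    rw [MonoidHom.ker_rangeRestrict]
    exact ⟨hker' x, hker x⟩
  let e : ψ.range ≃* (Fin r → Kˣ) :=
    (QuotientGroup.quotientKerEquivOfSurjective _ ψ.rangeRestrict_surjective).symm.trans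
      ((QuotientGroup.quotientMulEquivOfEq hkereq).trans
        (QuotientGroup.quotientKerEquivOfSurjective q hsurj))
  have he : ∀ x, e (ψ.rangeRestrict x) = q x := by
    intro x
    have h1 : (QuotientGroup.quotientKerEquivOfSurjective _ ψ.rangeRestrict_surjective).symm
        (ψ.rangeRestrict x) = (x : _ ⧸ ψ.rangeRestrict.ker) := by
      rw [MulEquiv.symm_apply_eq]
      rfl
    simp only [e, MulEquiv.trans_apply, h1]
    rfl
  refine ⟨r, e, isRegularMap_pi fun j => (isRegularMap_units_iff K _).2 ⟨?_, ?_⟩, ?_⟩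
  · obtain ⟨A, hA, hAx⟩ := (b j).2
    refine ⟨A, hA, ?_⟩
    funext ⟨_, x, rfl⟩
    exact (hAx x).trans (congrArg (fun c => ((c j : Kˣ) : K)) (he x)).symm
  · obtain ⟨A, hA, hAx⟩ := (-b j).2
    refine ⟨A, hA, ?_⟩
    funext ⟨_, x, rfl⟩
    exact (hAx x).trans (congrArg (fun c => (((c j)⁻¹ : Kˣ) : K)) (he x)).symm
  · rintro _ ⟨f, hf, rfl⟩
    obtain ⟨R, hR, hRx⟩ := hsum f hf
    convert hR using 1
    funext c
    obtain ⟨x, rfl⟩ := hsurj c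
    rw [← he]
    simp [← he, hRx]

end ImageTorus

/-! ### The group `SL₂` -/

section SL2

variable {K : Type*} [Field K]

/-- The group `SL₂(K)`. -/
abbrev SL2 (K : Type*) [Field K] := Matrix.SpecialLinearGroup (Fin 2) K

theorem sl2_ext {A B : SL2 K} (h00 : A.1 0 0 = B.1 0 0) (h01 : A.1 0 1 = B.1 0 1)
    (h10 : A.1 1 0 = B.1 1 0) (h11 : A.1 1 1 = B.1 1 1) : A = B := by
  ext i j; fin_cases i <;> fin_cases j <;> assumption

theorem sl2_det (A : SL2 K) : A.1 0 0 * A.1 1 1 - A.1 0 1 * A.1 1 0 = 1 := by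
  have := A.2
  rwa [Matrix.det_fin_two] at this

@[simp] theorem sl2_mul_apply (A B : SL2 K) (i j : Fin 2) :
    (A * B).1 i j = A.1 i 0 * B.1 0 j + A.1 i 1 * B.1 1 j := by
  change (A.1 * B.1) i j = _
  simp [Matrix.mul_apply]

/-- The upper unitriangular matrix with entry `x`. -/
def upper (x : K) : SL2 K := ⟨!![1, x; 0, 1], by simp [Matrix.det_fin_two]⟩

/-- The lower unitriangular matrix with entry `x`. -/
def lower (x : K) : SL2 K := ⟨!![1, 0; x, 1], by simp [Matrix.det_fin_two]⟩

@[simp] theorem sl2_one_00 : (1 : SL2 K).1 0 0 = 1 := by simp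
@[simp] theorem sl2_one_01 : (1 : SL2 K).1 0 1 = 0 := by simp
@[simp] theorem sl2_one_10 : (1 : SL2 K).1 1 0 = 0 := by simp
@[simp] theorem sl2_one_11 : (1 : SL2 K).1 1 1 = 1 := by simp
@[simp] theorem sl2_neg_apply (A : SL2 K) (i j : Fin 2) : (-A).1 i j = - A.1 i j := rfl
@[simp] theorem sl2_inv_00 (A : SL2 K) : (A⁻¹).1 0 0 = A.1 1 1 := by
  simp [Matrix.SpecialLinearGroup.SL2_inv_expl]
@[simp] theorem sl2_inv_01 (A : SL2 K) : (A⁻¹).1 0 1 = -A.1 0 1 := by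
  simp [Matrix.SpecialLinearGroup.SL2_inv_expl]
@[simp] theorem sl2_inv_10 (A : SL2 K) : (A⁻¹).1 1 0 = -A.1 1 0 := by
  simp [Matrix.SpecialLinearGroup.SL2_inv_expl]
@[simp] theorem sl2_inv_11 (A : SL2 K) : (A⁻¹).1 1 1 = A.1 0 0 := by
  simp [Matrix.SpecialLinearGroup.SL2_inv_expl]
@[simp] theorem upper_00 (x : K) : (upper x).1 0 0 = 1 := rfl
@[simp] theorem upper_01 (x : K) : (upper x).1 0 1 = x := rfl
@[simp] theorem upper_10 (x : K) : (upper x).1 1 0 = 0 := rfl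
@[simp] theorem upper_11 (x : K) : (upper x).1 1 1 = 1 := rfl
@[simp] theorem lower_00 (x : K) : (lower x).1 0 0 = 1 := rfl
@[simp] theorem lower_01 (x : K) : (lower x).1 0 1 = 0 := rfl
@[simp] theorem lower_10 (x : K) : (lower x).1 1 0 = x := rfl
@[simp] theorem lower_11 (x : K) : (lower x).1 1 1 = 1 := rfl
/-- The diagonal matrix `diag(a, a⁻¹)`. -/
def diagMatrix (a : Kˣ) : SL2 K := ⟨!![(a : K), 0; 0, (a : K)⁻¹], by simp [Matrix.det_fin_two]⟩

@[simp] theorem diagMatrix_00 (x : Kˣ) : (diagMatrix x).1 0 0 = x := rfl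
@[simp] theorem diagMatrix_01 (x : Kˣ) : (diagMatrix x).1 0 1 = 0 := rfl
@[simp] theorem diagMatrix_10 (x : Kˣ) : (diagMatrix x).1 1 0 = 0 := rfl
@[simp] theorem diagMatrix_11 (x : Kˣ) : (diagMatrix x).1 1 1 = (x : K)⁻¹ := rfl

/-- The parametrization `a ↦ diag(a, a⁻¹)` of the diagonal torus. -/
def diag : Kˣ →* SL2 K where
  toFun := diagMatrix
  map_one' := by apply sl2_ext <;> simp
  map_mul' a b := by apply sl2_ext <;> simp [mul_comm]

@[simp] theorem diag_00 (x : Kˣ) : (diag x).1 0 0 = x := rfl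
@[simp] theorem diag_01 (x : Kˣ) : (diag x).1 0 1 = 0 := rfl
@[simp] theorem diag_10 (x : Kˣ) : (diag x).1 1 0 = 0 := rfl
@[simp] theorem diag_11 (x : Kˣ) : (diag x).1 1 1 = (x : K)⁻¹ := rfl

theorem upper_add (x y : K) : upper (x + y) = upper x * upper y := by
  apply sl2_ext <;> simp [add_comm]

theorem upper_zero : upper (0 : K) = 1 := by apply sl2_ext <;> simp

theorem upper_inv (x : K) : (upper x)⁻¹ = upper (-x) := by apply sl2_ext <;> simp

theorem upper_injective : Function.Injective (upper : K → SL2 K) := fun x y h => by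
  simpa using congrArg (fun A : SL2 K => A.1 0 1) h

theorem lower_add (x y : K) : lower (x + y) = lower x * lower y := by
  apply sl2_ext <;> simp [add_comm]

theorem lower_zero : lower (0 : K) = 1 := by apply sl2_ext <;> simp

theorem diag_upper_diag_inv (a : Kˣ) (x : K) :
    diag a * upper x * (diag a)⁻¹ = upper ((a : K) ^ 2 * x) := by
  apply sl2_ext <;> simp [-mul_inv_rev]; ring

theorem exists_eq_diag {A : SL2 K} (h : A.1 1 0 = 0) (h' : A.1 0 1 = 0) : ∃ a, A = diag a := by
  have hd := sl2_det A
  rw [h, mul_zero, sub_zero] at hd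
  refine ⟨Units.mk0 (A.1 0 0) (left_ne_zero_of_mul_eq_one hd), ?_⟩
  apply sl2_ext <;> simp [h, h', eq_inv_of_mul_eq_one_right hd]

/-- An upper triangular matrix is the product of a diagonal and a unitriangular one. -/
theorem exists_eq_diag_mul_upper {A : SL2 K} (h : A.1 1 0 = 0) :
    ∃ a x, A = diag a * upper x := by
  have hd := sl2_det A
  rw [h, mul_zero, sub_zero] at hd
  refine ⟨Units.mk0 (A.1 0 0) (left_ne_zero_of_mul_eq_one hd), A.1 1 1 * A.1 0 1, ?_⟩
  apply sl2_ext <;> simp [h, eq_inv_of_mul_eq_one_right hd]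
  rw [mul_inv_cancel_left₀ (left_ne_zero_of_mul_eq_one hd)]

theorem trace_conj (D A : SL2 K) :
    (D * A * D⁻¹).1 0 0 + (D * A * D⁻¹).1 1 1 = A.1 0 0 + A.1 1 1 := by
  simp
  linear_combination (A.1 0 0 + A.1 1 1) * sl2_det D

theorem trace_pow_two (A : SL2 K) :
    (A ^ 2).1 0 0 + (A ^ 2).1 1 1 = (A.1 0 0 + A.1 1 1) ^ 2 - 2 := by
  rw [pow_two, sl2_mul_apply, sl2_mul_apply]
  linear_combination -2 * sl2_det A

theorem trace_pow_three (A : SL2 K) :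
    (A ^ 3).1 0 0 + (A ^ 3).1 1 1 = (A.1 0 0 + A.1 1 1) ^ 3 - 3 * (A.1 0 0 + A.1 1 1) := by
  simp only [pow_succ A, pow_zero, one_mul, sl2_mul_apply]
  linear_combination -3 * (A.1 0 0 + A.1 1 1) * sl2_det A

/-- An element of `SL₂` commuting with a nontrivial upper unitriangular matrix up to sign. -/
theorem eq_of_conj_upper [CharZero K] {A : SL2 K} {b c : K} (hb : b ≠ 0)
    (h : A * upper b * A⁻¹ = upper c ∨ A * upper b * A⁻¹ = -upper c) :
    A.1 1 0 = 0 ∧ c = A.1 0 0 ^ 2 * b ∧ A * upper b * A⁻¹ = upper c := by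
  have htr := trace_conj A (upper b)
  rcases h with h | h
  · refine ⟨?_, ?_, h⟩
    · have := congrArg (fun A : SL2 K => A.1 1 0) h
      simp at this
      have h2 : b * A.1 1 0 ^ 2 = 0 := by linear_combination -this
      simpa [hb] using h2
    · have := congrArg (fun A : SL2 K => A.1 0 1) h
      simp at this
      rw [← this]; ring
  · rw [h] at htr
    simp at htr
    exfalso
    have : (4 : K) = 0 := by linear_combination -htr
    norm_num at this

theorem upper_ne_neg_upper [CharZero K] (x y : K) : upper x ≠ -upper y := by
  intro h
  have := congrArg (fun A : SL2 K => A.1 0 0) h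
  simp at this
  have : (2 : K) = 0 := by linear_combination this
  norm_num at this

/-- Every element of `SL₂` with trace `±2` is, up to sign, conjugate to a unitriangular matrix. -/
theorem exists_conj_upper {A : SL2 K} (h : (A.1 0 0 + A.1 1 1) ^ 2 = 4) :
    ∃ (P : SL2 K) (b : K), P⁻¹ * A * P = upper b ∨ P⁻¹ * A * P = -upper b := by
  have hdet := sl2_det A
  have h' : A.1 0 0 + A.1 1 1 = 2 ∨ A.1 0 0 + A.1 1 1 = -2 := by
    rw [← sq_eq_sq_iff_eq_or_eq_neg, h]; norm_num
  obtain ⟨e, he, htr⟩ : ∃ e : K, (e = 1 ∨ e = -1) ∧ A.1 0 0 + A.1 1 1 = 2 * e := by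
    rcases h' with h' | h'
    · exact ⟨1, Or.inl rfl, by rw [h']; ring⟩
    · exact ⟨-1, Or.inr rfl, by rw [h']; ring⟩
  have hee : e * e = 1 := by rcases he with rfl | rfl <;> ring
  obtain ⟨P, hP⟩ : ∃ P : SL2 K, (P⁻¹ * A * P).1 1 0 = 0 := by
    by_cases hc : A.1 1 0 = 0
    · exact ⟨1, by simp [hc]⟩
    · let P : SL2 K := ⟨!![(A.1 0 0 - e) / A.1 1 0, -1; 1, 0], by simp [Matrix.det_fin_two]⟩
      have h00 : P.1 0 0 = (A.1 0 0 - e) / A.1 1 0 := rfl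
      have h01 : P.1 0 1 = -1 := rfl
      have h10 : P.1 1 0 = 1 := rfl
      have h11 : P.1 1 1 = 0 := rfl
      refine ⟨P, ?_⟩
      simp [h00, h10]
      field_simp
      linear_combination hdet - e * htr - hee
  have htr' := trace_conj P⁻¹ A
  rw [inv_inv] at htr'
  have hdet' := sl2_det (P⁻¹ * A * P)
  refine ⟨P, e * (P⁻¹ * A * P).1 0 1, ?_⟩
  generalize P⁻¹ * A * P = M at hP htr' hdet' ⊢
  rw [hP] at hdet'
  have h00 : M.1 0 0 = e := by
    have : (M.1 0 0 - e) ^ 2 = 0 := by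
      linear_combination M.1 0 0 * (htr'.trans htr) + hee - hdet'
    exact sub_eq_zero.1 (pow_eq_zero_iff two_ne_zero |>.1 this)
  have h11 : M.1 1 1 = e := by linear_combination htr'.trans htr - h00
  rcases he with rfl | rfl
  · exact Or.inl (by apply sl2_ext <;> simp [h00, h11, hP])
  · exact Or.inr (by apply sl2_ext <;> simp [h00, h11, hP])

end SL2

/-! ### Covers of groups of semisimple rank one -/

section Cover

variable {K : Type*} [Field K] {G : Type*} [Group G] [RegularFunctions K G] {n : ℕ}

/-- A homomorphism of algebraic groups `φ : SL₂ × (𝔾ₘ)ⁿ → G` that is surjective and whose kernel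
projects into the centre `{±1}` of `SL₂`. -/
structure IsCover (φ : SL2 K × (Fin n → Kˣ) →* G) : Prop where
  regular : IsRegularMap K φ
  surjective : Function.Surjective φ
  ker : ∀ A z, φ (A, z) = 1 → A = 1 ∨ A = -1

/-- A matrix commuting with infinitely many `upper x` and `lower x` is central; the conjugates of
an element of a finite normal subgroup by these one-parameter groups must coincide. -/
theorem isCover_of_finite_ker [CharZero K] {φ : SL2 K × (Fin n → Kˣ) →* G}
    (hreg : IsRegularMap K φ) (hsurj : Function.Surjective φ) (hfin : Finite φ.ker) :
    IsCover φ := by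
  refine ⟨hreg, hsurj, fun A z hA => ?_⟩
  have key : ∀ v : K → SL2 K, ∃ x y, x ≠ y ∧ v x * A * (v x)⁻¹ = v y * A * (v y)⁻¹ := by
    intro v
    let f : K → φ.ker := fun x => ⟨(v x, 1) * (A, z) * (v x, 1)⁻¹, by
      rw [MonoidHom.mem_ker, map_mul, map_mul, hA, mul_one, ← map_mul, mul_inv_cancel, map_one]⟩
    obtain ⟨x, y, hxy, h⟩ := Finite.exists_ne_map_eq_of_infinite f
    refine ⟨x, y, hxy, ?_⟩
    exact congrArg (fun p : φ.ker => p.1.1) h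
  obtain ⟨x, y, hxy, h⟩ := key upper
  obtain ⟨x', y', hxy', h'⟩ := key lower
  have hd := sl2_det A
  have e1 := congrArg (fun M : SL2 K => M.1 0 0) h
  have e2 := congrArg (fun M : SL2 K => M.1 0 1) h
  have e3 := congrArg (fun M : SL2 K => M.1 0 0) h'
  simp at e1 e2 e3
  have h10 : A.1 1 0 = 0 := by
    have : (x - y) * A.1 1 0 = 0 := by
      rcases e1 with h | h <;> simp [h]
    exact (mul_eq_zero.1 this).resolve_left (sub_ne_zero.2 hxy)
  have h01 : A.1 0 1 = 0 := by
    have : (x' - y') * A.1 0 1 = 0 := by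
      rcases e3 with h | h <;> simp [h]
    exact (mul_eq_zero.1 this).resolve_left (sub_ne_zero.2 hxy')
  have h11 : A.1 1 1 = A.1 0 0 := by
    have : (x - y) * (A.1 1 1 - A.1 0 0) = 0 := by
      linear_combination e2 + (x ^ 2 - y ^ 2) * h10
    exact sub_eq_zero.1 ((mul_eq_zero.1 this).resolve_left (sub_ne_zero.2 hxy))
  rw [h11, h10, mul_zero, sub_zero, mul_self_eq_one_iff] at hd
  rcases hd with hd | hd
  · left; apply sl2_ext <;> simp [h10, h01, h11, hd]
  · right; apply sl2_ext <;> simp [h10, h01, h11, hd]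

/-- The cover precomposed with the conjugation by `P ∈ SL₂`. -/
def conjCover (φ : SL2 K × (Fin n → Kˣ) →* G) (P : SL2 K) : SL2 K × (Fin n → Kˣ) →* G :=
  φ.comp ((MulAut.conj P).toMonoidHom.prodMap (MonoidHom.id _))

omit [RegularFunctions K G] in
theorem conjCover_apply (φ : SL2 K × (Fin n → Kˣ) →* G) (P A : SL2 K) (z : Fin n → Kˣ) :
    conjCover φ P (A, z) = φ (P * A * P⁻¹, z) := rfl

omit [RegularFunctions K G] in
theorem apply_eq_conjCover (φ : SL2 K × (Fin n → Kˣ) →* G) (P A : SL2 K) (z : Fin n → Kˣ) :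
    φ (A, z) = conjCover φ P (P⁻¹ * A * P, z) := by
  rw [conjCover_apply]; congr 2; group

namespace IsCover

variable {φ : SL2 K × (Fin n → Kˣ) →* G}

theorem conj (hφ : IsCover φ) (P : SL2 K) : IsCover (conjCover φ P) where
  regular := by
    refine hφ.regular.comp (IsRegularMap.prodMk (isRegularMap_sl2_iff.2 fun i j => ?_)
      isRegularMap_snd)
    have h : ∀ k l, (fun p : SL2 K × (Fin n → Kˣ) => p.1.1 k l) ∈
        coordRing K (SL2 K × (Fin n → Kˣ)) := fun k l => isRegularMap_fst _ (mem_coordRing_sl2 k l)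
    have hc : ∀ c : K, (fun _ : SL2 K × (Fin n → Kˣ) => c) ∈
        coordRing K (SL2 K × (Fin n → Kˣ)) := fun c => Subalgebra.algebraMap_mem _ c
    have hent : ∀ p : SL2 K × (Fin n → Kˣ), (P * p.1 * P⁻¹).1 i j =
        (P.1 i 0 * p.1.1 0 0 + P.1 i 1 * p.1.1 1 0) * P⁻¹.1 0 j +
        (P.1 i 0 * p.1.1 0 1 + P.1 i 1 * p.1.1 1 1) * P⁻¹.1 1 j := fun p => by
      simp only [sl2_mul_apply]
    change (fun p : SL2 K × (Fin n → Kˣ) => (P * p.1 * P⁻¹).1 i j) ∈ _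
    simp only [hent]
    exact add_mem (mul_mem (add_mem (mul_mem (hc _) (h _ _)) (mul_mem (hc _) (h _ _))) (hc _))
      (mul_mem (add_mem (mul_mem (hc _) (h _ _)) (mul_mem (hc _) (h _ _))) (hc _))
  surjective g := by
    obtain ⟨⟨A, z⟩, rfl⟩ := hφ.surjective g
    exact ⟨_, (apply_eq_conjCover φ P A z).symm⟩
  ker A z h := by
    have hA : A = P⁻¹ * (P * A * P⁻¹) * P := by group
    rw [conjCover_apply] at h
    rcases hφ.ker _ _ h with h | h <;> rw [hA, h]
    · left; group
    · right; simp

theorem lift_eq (hφ : IsCover φ) {A A' : SL2 K} {z z' : Fin n → Kˣ} (h : φ (A, z) = φ (A', z')) :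
    A = A' ∨ A = -A' := by
  have h1 : φ (A'⁻¹ * A, z'⁻¹ * z) = 1 := by
    rw [← Prod.mk_mul_mk, map_mul, ← Prod.inv_mk, map_inv, h, inv_mul_cancel]
  have hA : A = A' * (A'⁻¹ * A) := by group
  rcases hφ.ker _ _ h1 with h | h <;> rw [hA, h]
  · left; group
  · right; simp

theorem commute_of_neg_one (hφ : IsCover φ) {A : SL2 K} (hA : A = 1 ∨ A = -1) (z : Fin n → Kˣ)
    (g : G) : φ (A, z) * g = g * φ (A, z) := by
  obtain ⟨⟨M, w⟩, rfl⟩ := hφ.surjective g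
  rw [← map_mul, ← map_mul]
  congr 1
  rcases hA with rfl | rfl <;> simp [mul_comm]

end IsCover

variable [CharZero K]

section Root

variable {T : Subgroup G} {α : characterLattice K T} {u : Multiplicative K →* G}
  {φ : SL2 K × (Fin n → Kˣ) →* G}

omit [RegularFunctions K G] [CharZero K] in
theorem apply_ofAdd_add (s t : K) : u (Multiplicative.ofAdd (s + t)) =
    u (Multiplicative.ofAdd s) * u (Multiplicative.ofAdd t) := by
  rw [ofAdd_add, map_mul]

/-- The lifts to `SL₂` of the elements `u(s)` of a root subgroup have trace `±2`, because `u(s)`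
is conjugate to its square `u(2s)` and to its cube `u(3s)`. -/
theorem IsCover.trace_lift (hφ : IsCover φ) (hα : ∀ a : K, a ≠ 0 → ∃ t, charValue K α t = a)
    (hu : ∀ (t : T) (s : K), (t : G) * u (Multiplicative.ofAdd s) * (t : G)⁻¹ =
      u (Multiplicative.ofAdd (charValue K α t * s)))
    {A : SL2 K} {z : Fin n → Kˣ} {s : K} (hA : φ (A, z) = u (Multiplicative.ofAdd s)) :
    (A.1 0 0 + A.1 1 1) ^ 2 = 4 := by
  have key : ∀ (k : ℕ), (k : K) ≠ 0 → ((A ^ k).1 0 0 + (A ^ k).1 1 1) ^ 2 =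
      (A.1 0 0 + A.1 1 1) ^ 2 := by
    intro k hk
    obtain ⟨t, ht⟩ := hα k hk
    obtain ⟨⟨D, w⟩, hD⟩ := hφ.surjective (t : G)
    have h := hu t s
    rw [ht, ← nsmul_eq_mul, ofAdd_nsmul, map_pow, ← hA, ← hD, ← map_inv, ← map_mul, ← map_mul,
      ← map_pow] at h
    rw [← trace_conj D A]
    rcases hφ.lift_eq (A := D * A * D⁻¹) (A' := A ^ k) (z := w * z * w⁻¹) (z' := z ^ k) h
      with h | h
    · rw [h]
    · rw [h, sl2_neg_apply, sl2_neg_apply]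
      ring
  have h2 := key 2 (by norm_num)
  have h3 := key 3 (by norm_num)
  rw [trace_pow_two] at h2
  rw [trace_pow_three] at h3
  set x := A.1 0 0 + A.1 1 1
  have h3' : x ^ 2 * (x ^ 2 - 3) ^ 2 = x ^ 2 := by linear_combination h3
  -- `τ = x²` satisfies `(τ - 2)² = τ` and `τ (τ - 3)² = τ`, whose only common root is `4`
  linear_combination (x ^ 2 - 1) * h2 - h3'

end Root
end Cover

/-! ### Lifting a root subgroup to `SL₂` -/

section UnipotentLift

variable {K : Type*} [Field K] {G : Type*} [Group G] [RegularFunctions K G] {n : ℕ}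
  {φ : SL2 K × (Fin n → Kˣ) →* G}

/-- The element `g` of `G` has a lift to `SL₂ × (𝔾ₘ)ⁿ` whose first component is `± upper y`. -/
def HasUpperLift (φ : SL2 K × (Fin n → Kˣ) →* G) (g : G) (y : K) : Prop :=
  ∃ A z, φ (A, z) = g ∧ (A = upper y ∨ A = -upper y)

theorem conj_upper_of_triangular {D : SL2 K} (hD : D.1 1 0 = 0) (y : K) :
    D * upper y * D⁻¹ = upper (D.1 0 0 ^ 2 * y) := by
  have hd := sl2_det D
  rw [hD, mul_zero, sub_zero] at hd
  apply sl2_ext <;> simp [hD]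
  · exact hd
  · ring
  · linear_combination hd

theorem HasUpperLift.unique [CharZero K] (hφ : IsCover φ) {g : G} {y y' : K}
    (h : HasUpperLift φ g y) (h' : HasUpperLift φ g y') : y = y' := by
  obtain ⟨A, z, hA, h⟩ := h
  obtain ⟨A', z', hA', h'⟩ := h'
  have hpm : upper y = upper y' ∨ upper y = -upper y' := by
    rcases hφ.lift_eq (hA.trans hA'.symm) with e | e <;> rcases h with rfl | rfl <;>
      rcases h' with rfl | rfl <;> simp_all [neg_eq_iff_eq_neg]
  rcases hpm with h | h
  · exact upper_injective h
  · exact absurd h (upper_ne_neg_upper _ _)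

omit [RegularFunctions K G] in
theorem HasUpperLift.mul {g g' : G} {y y' : K} (h : HasUpperLift φ g y)
    (h' : HasUpperLift φ g' y') : HasUpperLift φ (g * g') (y + y') := by
  obtain ⟨A, z, rfl, h⟩ := h
  obtain ⟨A', z', rfl, h'⟩ := h'
  refine ⟨A * A', z * z', by rw [← map_mul]; rfl, ?_⟩
  rw [upper_add]
  rcases h with rfl | rfl <;> rcases h' with rfl | rfl <;> simp

theorem HasUpperLift.exists_central (hφ : IsCover φ) {g : G} {y : K} (h : HasUpperLift φ g y) :
    ∃ c : G, (∀ g', c * g' = g' * c) ∧ g = c * φ (upper y, 1) := by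
  obtain ⟨A, z, rfl, rfl | rfl⟩ := h
  · exact ⟨φ (1, z), hφ.commute_of_neg_one (Or.inl rfl) z, by rw [← map_mul]; simp⟩
  · exact ⟨φ (-1, z), hφ.commute_of_neg_one (Or.inr rfl) z, by rw [← map_mul]; simp⟩

theorem HasUpperLift.conj_eq [CharZero K] (hφ : IsCover φ) {g : G} {y y' : K} {D : SL2 K}
    {w : Fin n → Kˣ} (hy : y ≠ 0) (h : HasUpperLift φ g y)
    (h' : HasUpperLift φ (φ (D, w) * g * (φ (D, w))⁻¹) y') : D.1 1 0 = 0 ∧ y' = D.1 0 0 ^ 2 * y := by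
  obtain ⟨A, z, rfl, h⟩ := h
  obtain ⟨A', z', hA', h'⟩ := h'
  rw [← map_inv, ← map_mul, ← map_mul] at hA'
  have hpm : D * upper y * D⁻¹ = upper y' ∨ D * upper y * D⁻¹ = -upper y' := by
    rcases hφ.lift_eq (A := A') (A' := D * A * D⁻¹) (z' := w * z * w⁻¹) hA' with e | e <;>
    rcases h with rfl | rfl <;> rcases h' with rfl | rfl <;>
      simp_all [neg_eq_iff_eq_neg]
  obtain ⟨h1, h2, -⟩ := eq_of_conj_upper hy hpm
  exact ⟨h1, h2⟩

theorem isRegularMap_upper_one :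
    IsRegularMap K (fun s : K => ((upper s, 1) : SL2 K × (Fin n → Kˣ))) := by
  refine IsRegularMap.prodMk (isRegularMap_sl2_iff.2 fun i j => ?_) (isRegularMap_const _)
  fin_cases i <;> fin_cases j
  · exact Subalgebra.algebraMap_mem _ (1 : K)
  · exact id_mem_coordRing_affineLine
  · exact Subalgebra.algebraMap_mem _ (0 : K)
  · exact Subalgebra.algebraMap_mem _ (1 : K)

variable [CharZero K] {T : Subgroup G} {α : characterLattice K T} {u : Multiplicative K →* G}

/-- An additive reparametrization of a one-parameter unipotent subgroup is linear as soon as both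
parametrizations are regular. -/
theorem reparametrization_linear (hG : IsLinearAlgebraicGroup K G) (hφ : IsCover φ)
    (hreg : IsRegularMap K (fun s : K => u (Multiplicative.ofAdd s)))
    (hinj : Function.Injective u) {β : K → K} (hβ1 : β 1 ≠ 0) (hadd : ∀ s t, β (s + t) = β s + β t)
    (hβ : ∀ s, u (Multiplicative.ofAdd s) = φ (upper (β s), 1)) (s : K) : β s = β 1 * s := by
  have hβ0 : β 0 = 0 := by simpa using hadd 0 0
  have hβn : ∀ k : ℕ, β k = β 1 * k := by
    intro k
    induction k with
    | zero => simp [hβ0]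
    | succ k ih => rw [Nat.cast_succ, hadd, ih]; ring
  by_contra hne
  set c := β s - β 1 * s with hc
  have hc0 : c ≠ 0 := sub_ne_zero.2 hne
  have hu1 : u (Multiplicative.ofAdd 1) = 1 := by
    refine hG.isAffineVariety.ext fun f hf => ?_
    obtain ⟨p, hp⟩ := exists_polynomial_of_mem_coordRing_affineLine
      ((hφ.regular.comp isRegularMap_upper_one) f hf)
    obtain ⟨q, hq⟩ := exists_polynomial_of_mem_coordRing_affineLine (hreg f hf)
    have hq' : ∀ s, q.eval s = p.eval (β s) := fun s => by
      rw [← hq, ← hp, pullback_apply, hβ]; rfl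
    -- the two parametrizations agree on `s + ℕ`, which is Zariski dense
    have hpoly : ∀ s x, p.eval (β 1 * x + β s) = q.eval (x + s) := by
      intro s
      have : p.comp (Polynomial.C (β 1) * Polynomial.X + Polynomial.C (β s)) =
          q.comp (Polynomial.X + Polynomial.C s) := by
        refine Polynomial.eq_of_infinite_eval_eq _ _
          ((Set.infinite_range_of_injective (Nat.cast_injective (R := K))).mono ?_)
        rintro _ ⟨k, rfl⟩
        simp [hq', hadd, hβn]
      intro x
      simpa using congrArg (Polynomial.eval x) this
    have hper : ∀ y, p.eval (y + c) = p.eval y := by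
      intro y
      have h1 := hpoly s (y / β 1 - s)
      have h2 := hpoly 0 (y / β 1)
      rw [sub_add_cancel] at h1
      rw [hβ0, add_zero, add_zero, ← h1] at h2
      have e1 : β 1 * (y / β 1) = y := by field_simp
      have e2 : β 1 * (y / β 1 - s) + β s = y + c := by rw [mul_sub, e1, hc]; ring
      rw [e1, e2] at h2
      exact h2.symm
    have hpc : p = Polynomial.C (p.eval 0) := by
      refine Polynomial.eq_of_infinite_eval_eq _ _ ((Set.infinite_range_of_injective
        (f := fun k : ℕ => (k : K) * c) fun a b h => ?_).mono ?_)
      · simpa [hc0] using h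
      · rintro _ ⟨k, rfl⟩
        rw [Set.mem_ofPred_eq, Polynomial.eval_C]
        induction k with
        | zero => simp
        | succ k ih =>
          simp only [Nat.cast_succ, add_mul, one_mul]
          rw [hper, ih]
    have h1 : f (u (Multiplicative.ofAdd 1)) = p.eval (β 1) := (hq 1).trans (hq' 1)
    have h2 : f (u (Multiplicative.ofAdd 0)) = p.eval (β 0) := (hq 0).trans (hq' 0)
    rw [ofAdd_zero, map_one] at h2
    rw [h1, h2, hpc, Polynomial.eval_C, Polynomial.eval_C]
  have := hinj (hu1.trans (map_one u).symm)
  exact one_ne_zero (α := K) this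

/-- After conjugation, a root subgroup of `G` is the image of the group of upper unitriangular
matrices. -/
theorem exists_cover_upper [IsAlgClosed K] (hG : IsLinearAlgebraicGroup K G) (hφ : IsCover φ)
    (hα : ∀ a : K, a ≠ 0 → ∃ t, charValue K α t = a)
    (hreg : IsRegularMap K (fun s : K => u (Multiplicative.ofAdd s)))
    (hinj : Function.Injective u)
    (hu : ∀ (t : T) (s : K), (t : G) * u (Multiplicative.ofAdd s) * (t : G)⁻¹ =
      u (Multiplicative.ofAdd (charValue K α t * s))) :
    ∃ φ' : SL2 K × (Fin n → Kˣ) →* G, IsCover φ' ∧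
      ∀ s, u (Multiplicative.ofAdd s) = φ' (upper s, 1) := by
  have h2ne : (2 : K) ≠ 0 := by norm_num
  obtain ⟨t, ht⟩ := hα 2 h2ne
  -- `u(1)` has a unitriangular lift after conjugation
  obtain ⟨⟨A, z⟩, hA⟩ := hφ.surjective (u (Multiplicative.ofAdd 1))
  obtain ⟨P, b, hPb⟩ := exists_conj_upper (hφ.trace_lift hα hu hA)
  have hφ1 := hφ.conj P
  rw [apply_eq_conjCover φ P] at hA
  generalize conjCover φ P = ψ at hφ1 hA
  have hu1 : HasUpperLift ψ (u (Multiplicative.ofAdd 1)) b := ⟨_, _, hA, hPb⟩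
  have hb : b ≠ 0 := by
    rintro rfl
    obtain ⟨c, hc, h⟩ := hu1.exists_central hφ1
    rw [upper_zero, show ((1, 1) : SL2 K × (Fin n → Kˣ)) = 1 from rfl, map_one ψ, mul_one] at h
    have := hu t 1
    rw [ht, h, ← hc, mul_inv_cancel_right, ← h, mul_one] at this
    have := hinj this
    have h12 : (1 : K) = 2 := this
    norm_num at h12
  have hlift : ∀ s, ∃ y, HasUpperLift ψ (u (Multiplicative.ofAdd s)) y := by
    intro s
    obtain ⟨⟨D, w⟩, hD⟩ := hφ1.surjective (u (Multiplicative.ofAdd s))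
    have hcomm : ψ (D, w) * u (Multiplicative.ofAdd 1) * (ψ (D, w))⁻¹ =
        u (Multiplicative.ofAdd 1) := by
      rw [hD, ← map_mul, ← map_inv, ← map_mul]
      congr 1
      rw [mul_comm, inv_mul_cancel_left]
    obtain ⟨h10, h00⟩ := hu1.conj_eq hφ1 hb (by rw [hcomm]; exact hu1)
    have hd := sl2_det D
    rw [h10, mul_zero, sub_zero] at hd
    have hsq : D.1 0 0 ^ 2 = 1 := by
      have : D.1 0 0 ^ 2 * b = 1 * b := by rw [← h00, one_mul]
      exact mul_right_cancel₀ hb this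
    rw [pow_two, mul_self_eq_one_iff] at hsq
    rcases hsq with h | h
    · refine ⟨D.1 0 1, D, w, hD, Or.inl ?_⟩
      rw [h, one_mul] at hd
      apply sl2_ext <;> simp [h, h10, hd]
    · refine ⟨-D.1 0 1, D, w, hD, Or.inr ?_⟩
      rw [h, neg_one_mul, neg_eq_iff_eq_neg] at hd
      apply sl2_ext <;> simp [h, h10, hd]
  choose β hβ using hlift
  have hβ1 : β 1 ≠ 0 := by rw [(hβ 1).unique hφ1 hu1]; exact hb
  have hadd : ∀ s t, β (s + t) = β s + β t := fun s t => by
    refine (hβ (s + t)).unique hφ1 ?_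
    rw [apply_ofAdd_add]
    exact (hβ s).mul (hβ t)
  -- the central defect `c` of the lift satisfies `c ^ 2 = c`
  have hβu : ∀ s, u (Multiplicative.ofAdd s) = ψ (upper (β s), 1) := by
    intro s
    obtain ⟨c, hc, hs⟩ := (hβ s).exists_central hφ1
    obtain ⟨⟨D, w⟩, hD⟩ := hφ1.surjective (t : G)
    have hts : ∀ r, ψ (D, w) * u (Multiplicative.ofAdd r) * (ψ (D, w))⁻¹ =
        u (Multiplicative.ofAdd (r + r)) := fun r => by
      rw [hD, hu t r, ht, two_mul]
    obtain ⟨h10, -⟩ := (hβ 1).conj_eq hφ1 hβ1 (by rw [hts 1]; exact hβ _)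
    have h1 : u (Multiplicative.ofAdd (s + s)) = c * ψ (upper (D.1 0 0 ^ 2 * β s), 1) := by
      rw [← hts, hs, ← mul_assoc, ← hc, mul_assoc, mul_assoc, ← map_inv, ← map_mul, ← map_mul]
      congr 2
      refine Prod.ext ?_ ?_
      · change D * (upper (β s) * D⁻¹) = _
        rw [← conj_upper_of_triangular h10, mul_assoc]
      · simp
    have h2 : u (Multiplicative.ofAdd (s + s)) = c * c * ψ (upper (β s + β s), 1) := by
      rw [apply_ofAdd_add, hs, upper_add]
      have : ((upper (β s) * upper (β s), 1) : SL2 K × (Fin n → Kˣ)) =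
        (upper (β s), 1) * (upper (β s), 1) := by simp
      rw [this, map_mul, mul_assoc, ← mul_assoc (ψ _) c, ← hc]
      simp only [mul_assoc]
    have h3 : D.1 0 0 ^ 2 * β s = β s + β s := by
      by_cases h0 : β s = 0
      · rw [h0]; ring
      · rw [← ((hβ s).conj_eq hφ1 h0 (by rw [hts s]; exact hβ _)).2, hadd]
    rw [h1, h3] at h2
    have : c = 1 := by simpa [mul_assoc] using h2
    rw [hs, this, one_mul]
  have hlin := reparametrization_linear hG hφ1 hreg hinj hβ1 hadd hβu
  obtain ⟨r, hr⟩ := units_exists_pow_eq (Units.mk0 (β 1) hβ1) two_ne_zero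
  refine ⟨conjCover ψ (diag r), hφ1.conj _, fun s => ?_⟩
  rw [hβu, conjCover_apply, diag_upper_diag_inv, hlin]
  congr 3
  rw [← Units.val_pow_eq_pow_val, hr]
  rfl

end UnipotentLift

/-! ### Covers adapted to a Borel subgroup and a maximal torus -/

section AdaptedCover

variable {K : Type*} [Field K] {G : Type*} [Group G] [RegularFunctions K G] {n : ℕ}

/-- A cover `SL₂ × (𝔾ₘ)ⁿ → G` in standard position with respect to `B`, `T`, `α`: the upper
unitriangular matrices map into `B`, the image of the diagonal torus is `T`, with `α` corresponding
to the root `diag(a, a⁻¹) ↦ a²`, and `B` consists of images of upper triangular matrices. -/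
structure IsAdaptedCover (B T : Subgroup G) (α : characterLattice K T)
    (φ : SL2 K × (Fin n → Kˣ) →* G) : Prop where
  regular : IsRegularMap K φ
  surjective : Function.Surjective φ
  upper_mem : ∀ s, φ (upper s, 1) ∈ B
  mem_torus : ∀ g, g ∈ T ↔ ∃ a z, g = φ (diag a, z)
  root : ∀ (t : T) a z, (t : G) = φ (diag a, z) → charValue K α t = (a : K) ^ 2
  borel : ∀ b ∈ B, ∃ a z x, b = φ (diag a, z) * φ (upper x, 1)

theorem diag_lower_diag_inv (a : Kˣ) (x : K) :
    diag a * lower x * (diag a)⁻¹ = lower (((a : K) ^ 2)⁻¹ * x) := by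
  apply sl2_ext <;> simp [-mul_inv_rev]
  field_simp

/-- The diagonal torus is contained in the group generated by the unitriangular matrices. -/
theorem diag_eq_word (a : Kˣ) : diag a =
    upper (a : K) * lower (-(a : K)⁻¹) * upper (a : K) *
      (upper (-1) * lower 1 * upper (-1)) := by
  apply sl2_ext <;> simp

theorem conj_weyl (c x : K) (hc : c ≠ 0) {M : SL2 K} (h00 : M.1 0 0 = 0) (h10 : M.1 1 0 = c)
    (h11 : M.1 1 1 = 0) : M * upper (-(c ^ 2)⁻¹ * x) * M⁻¹ = lower x := by
  have hd := sl2_det M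
  rw [h00, h10, zero_mul, zero_sub] at hd
  apply sl2_ext <;> simp [h00, h10, h11]
  · linear_combination hd
  · field_simp
  · linear_combination hd

theorem upper_mul_mul_upper (h : SL2 K) (hc : h.1 1 0 ≠ 0) :
    (upper (-(h.1 0 0 / h.1 1 0)) * h * upper (-(h.1 1 1 / h.1 1 0))).1 0 0 = 0 ∧
    (upper (-(h.1 0 0 / h.1 1 0)) * h * upper (-(h.1 1 1 / h.1 1 0))).1 1 0 = h.1 1 0 ∧
    (upper (-(h.1 0 0 / h.1 1 0)) * h * upper (-(h.1 1 1 / h.1 1 0))).1 1 1 = 0 := by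
  refine ⟨?_, ?_, ?_⟩ <;> simp <;> field_simp <;> ring

/-- A solvable subgroup of `G` containing the image of the upper unitriangular matrices consists
of images of upper triangular matrices: otherwise it contains the image of `SL₂`, which is
perfect. -/
theorem triangular_of_solvable [CharZero K] {φ : SL2 K × (Fin n → Kˣ) →* G} (hφ : IsCover φ)
    {B : Subgroup G} (hB : Group.IsSolvable B) (hU : ∀ s, φ (upper s, 1) ∈ B) {h : SL2 K}
    {z : Fin n → Kˣ} (hh : φ (h, z) ∈ B) : h.1 1 0 = 0 := by
  by_contra hc
  have hmul : ∀ A A' : SL2 K, φ (A * A', 1) = φ (A, 1) * φ (A', 1) := fun A A' => by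
    rw [← map_mul]; simp
  have hL : ∀ s, φ (lower s, 1) ∈ B := by
    intro s
    obtain ⟨h00, h10, h11⟩ := upper_mul_mul_upper h hc
    set M := upper (-(h.1 0 0 / h.1 1 0)) * h * upper (-(h.1 1 1 / h.1 1 0))
    have hM : φ (M, z) ∈ B := by
      have : φ (M, z) = φ (upper (-(h.1 0 0 / h.1 1 0)), 1) * φ (h, z) *
          φ (upper (-(h.1 1 1 / h.1 1 0)), 1) := by
        rw [← map_mul, ← map_mul]; simp [M]
      rw [this]
      exact mul_mem (mul_mem (hU _) hh) (hU _)
    have := mul_mem (mul_mem hM (hU (-(h.1 1 0 ^ 2)⁻¹ * s))) (inv_mem hM)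
    rw [← map_inv, ← map_mul, ← map_mul] at this
    convert this
    · exact (conj_weyl _ s hc h00 h10 h11).symm
    · simp
  obtain ⟨k, hk⟩ := hB.solvable
  have key : ∀ m, ∀ s, (⟨φ (upper s, 1), hU s⟩ : B) ∈ derivedSeries B m ∧
      (⟨φ (lower s, 1), hL s⟩ : B) ∈ derivedSeries B m := by
    intro m
    induction m with
    | zero => intro s; simp
    | succ m ih =>
      intro s
      have two : (2 : K) ≠ 0 := by norm_num
      let a : Kˣ := Units.mk0 2 two
      let d : B := ⟨φ (upper (a : K), 1), hU _⟩ * ⟨φ (lower (-(a : K)⁻¹), 1), hL _⟩ *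
        ⟨φ (upper (a : K), 1), hU _⟩ * (⟨φ (upper (-1), 1), hU _⟩ * ⟨φ (lower 1, 1), hL _⟩ *
        ⟨φ (upper (-1), 1), hU _⟩)
      have hd : (d : G) = φ (diag a, 1) := by
        rw [diag_eq_word]; simp only [hmul]; rfl
      have hdm : d ∈ derivedSeries B m :=
        mul_mem (mul_mem (mul_mem (ih _).1 (ih _).2) (ih _).1)
          (mul_mem (mul_mem (ih _).1 (ih _).2) (ih _).1)
      have hinv : ∀ A : SL2 K, (φ (A, 1))⁻¹ = φ (A⁻¹, 1) := fun A => by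
        rw [← map_inv]; simp
      rw [derivedSeries_succ]
      constructor
      · convert Subgroup.commutator_mem_commutator hdm (ih (s / 3)).1 using 1
        apply Subtype.ext
        simp only [commutatorElement_def, Subgroup.coe_mul, Subgroup.coe_inv, hd, hinv]
        rw [← hmul, ← hmul, ← hmul, diag_upper_diag_inv, upper_inv, ← upper_add]
        congr 3
        simp only [a, Units.val_mk0]
        ring
      · convert Subgroup.commutator_mem_commutator hdm (ih (-4 * s / 3)).2 using 1
        apply Subtype.ext
        simp only [commutatorElement_def, Subgroup.coe_mul, Subgroup.coe_inv, hd, hinv]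
        have hlinv : ∀ x : K, (lower x)⁻¹ = lower (-x) := fun x => by apply sl2_ext <;> simp
        rw [← hmul, ← hmul, ← hmul, diag_lower_diag_inv, hlinv, ← lower_add]
        congr 3
        simp only [a, Units.val_mk0]
        ring
  have h1 := (key k 1).1
  rw [hk, Subgroup.mem_bot] at h1
  have h2 : φ (upper 1, 1) = φ (1, 1) := (congrArg Subtype.val h1).trans (map_one φ).symm
  rcases hφ.lift_eq h2 with h | h
  · have := congrArg (fun A : SL2 K => A.1 0 1) h
    simp at this
  · have := congrArg (fun A : SL2 K => A.1 0 1) h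
    simp at this

theorem isTorus_diagonal [IsAlgClosed K] (hG : IsLinearAlgebraicGroup K G)
    {φ : SL2 K × (Fin n → Kˣ) →* G} (hφ : IsCover φ) :
    ∃ S : Subgroup G, IsTorus K S ∧ ∀ g, g ∈ S ↔ ∃ a z, g = φ (diag a, z) := by
  let ι : (Fin (n + 1) → Kˣ) →* SL2 K × (Fin n → Kˣ) :=
    { toFun := fun x => (diag (x 0), Fin.tail x)
      map_one' := by rw [Pi.one_apply, map_one]; rfl
      map_mul' := fun x y => by rw [Pi.mul_apply, map_mul]; rfl }
  have hι : IsRegularMap K ι := by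
    refine IsRegularMap.prodMk (isRegularMap_sl2_iff.2 fun i j => ?_)
      (isRegularMap_pi fun i => isRegularMap_eval i.succ)
    have h0 := (isRegularMap_units_iff K (fun x : Fin (n + 1) → Kˣ => x 0)).1 (isRegularMap_eval 0)
    fin_cases i <;> fin_cases j
    · exact h0.1
    · exact Subalgebra.algebraMap_mem _ (0 : K)
    · exact Subalgebra.algebraMap_mem _ (0 : K)
    · simpa using h0.2
  refine ⟨(φ.comp ι).range, isTorus_range hG (hφ.regular.comp hι), fun g => ?_⟩
  constructor
  · rintro ⟨x, rfl⟩
    exact ⟨x 0, Fin.tail x, rfl⟩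
  · rintro ⟨a, z, rfl⟩
    exact ⟨Fin.cons a z, rfl⟩

theorem IsTorus.commute {T : Subgroup G} (hT : IsTorus K T) (s t : T) : s * t = t * s := by
  obtain ⟨m, e, -, -⟩ := hT.exists_iso
  apply e.injective
  rw [map_mul, map_mul, mul_comm]

theorem exists_adaptedCover [IsAlgClosed K] [CharZero K] (hG : IsLinearAlgebraicGroup K G)
    (hrank : HasSemisimpleRankOne K G) {B T : Subgroup G} (hB : IsBorelSubgroup K B)
    (hT : IsMaximalTorus K T) {α : characterLattice K T} (hα : IsPositiveRoot K B T α) :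
    ∃ (n : ℕ) (φ : SL2 K × (Fin n → Kˣ) →* G), IsAdaptedCover B T α φ := by
  obtain ⟨n, φ₀, hreg, hsurj, hfin⟩ := hrank
  obtain ⟨hα0, u, hureg, huinj, huB, hu⟩ := hα
  have hTt : IsTorus K T := hT.prop
  have hαsurj : ∀ a : K, a ≠ 0 → ∃ t, charValue K α t = a :=
    fun a ha => hTt.charValue_surjective hα0 ha
  obtain ⟨φ₁, hφ₁, hu₁⟩ := exists_cover_upper hG (isCover_of_finite_ker hreg hsurj hfin) hαsurj
    hureg huinj hu
  have htri : ∀ φ : SL2 K × (Fin n → Kˣ) →* G, IsCover φ →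
      (∀ s, u (Multiplicative.ofAdd s) = φ (upper s, 1)) → ∀ (t : T) D w, φ (D, w) = t →
      D.1 1 0 = 0 ∧ charValue K α t = D.1 0 0 ^ 2 := by
    intro φ hφ hu' t D w hD
    have h := hu t 1
    rw [hu', hu', ← hD, ← map_inv, ← map_mul, ← map_mul, mul_one] at h
    obtain ⟨h1, h2, -⟩ := eq_of_conj_upper one_ne_zero
      (hφ.lift_eq (A := D * upper 1 * D⁻¹) (z := w * 1 * w⁻¹) h)
    exact ⟨h1, by rw [h2, mul_one]⟩
  -- an element of `T` with distinct eigenvalues is made diagonal by a unitriangular conjugation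
  obtain ⟨t₀, ht₀⟩ := hαsurj 4 (by norm_num)
  obtain ⟨⟨D₀, w₀⟩, hD₀⟩ := hφ₁.surjective (t₀ : G)
  obtain ⟨h10, h00⟩ := htri φ₁ hφ₁ hu₁ t₀ D₀ w₀ hD₀
  have hd := sl2_det D₀
  rw [h10, mul_zero, sub_zero] at hd
  have hne : D₀.1 0 0 - D₀.1 1 1 ≠ 0 := by
    intro h
    rw [sub_eq_zero] at h
    rw [← h, ← pow_two, ← h00, ht₀] at hd
    norm_num at hd
  let P : SL2 K := upper (-D₀.1 0 1 / (D₀.1 0 0 - D₀.1 1 1))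
  have hφ := hφ₁.conj P
  have hu₂ : ∀ s, u (Multiplicative.ofAdd s) = conjCover φ₁ P (upper s, 1) := by
    intro s
    rw [hu₁, conjCover_apply, upper_inv, ← upper_add, ← upper_add]
    congr 3; ring
  have hD₁ : P⁻¹ * D₀ * P = diag (Units.mk0 _ (left_ne_zero_of_mul_eq_one hd)) := by
    apply sl2_ext <;> simp [P, upper_inv, h10, eq_inv_of_mul_eq_one_right hd]
    rw [← eq_inv_of_mul_eq_one_right hd]
    field_simp
    ring
  rw [apply_eq_conjCover φ₁ P, hD₁] at hD₀
  generalize conjCover φ₁ P = φ at hφ hu₂ hD₀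
  set d₀ := Units.mk0 _ (left_ne_zero_of_mul_eq_one hd)
  have hTd : ∀ t : T, ∃ a z, (t : G) = φ (diag a, z) := by
    intro t
    obtain ⟨⟨D, w⟩, hD⟩ := hφ.surjective (t : G)
    obtain ⟨h10', -⟩ := htri φ hφ hu₂ t D w hD
    have hd' := sl2_det D
    rw [h10', mul_zero, sub_zero] at hd'
    have hcomm : φ (D * diag d₀, w * w₀) = φ (diag d₀ * D, w₀ * w) := by
      rw [← Prod.mk_mul_mk, ← Prod.mk_mul_mk, map_mul, map_mul, hD, hD₀]
      exact congrArg Subtype.val (hTt.commute t t₀)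
    have h01 : D.1 0 1 = 0 := by
      have hda : (d₀ : K) = D₀.1 0 0 := rfl
      have hdb : (d₀ : K)⁻¹ = D₀.1 1 1 := (eq_inv_of_mul_eq_one_right hd).symm
      rcases hφ.lift_eq hcomm with h | h
      · have := congrArg (fun A : SL2 K => A.1 0 1) h
        simp only [sl2_mul_apply, diag_00, diag_01, diag_11] at this
        rw [hdb, hda] at this
        have h2 : (D₀.1 0 0 - D₀.1 1 1) * D.1 0 1 = 0 := by linear_combination -this
        exact (mul_eq_zero.1 h2).resolve_left hne
      · exfalso
        have := congrArg (fun A : SL2 K => A.1 0 0) h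
        simp only [sl2_mul_apply, sl2_neg_apply, diag_00, diag_01, diag_10, hda] at this
        have h2 : 2 * (D₀.1 0 0 * D.1 0 0) = 0 := by linear_combination this
        exact mul_ne_zero two_ne_zero (mul_ne_zero (left_ne_zero_of_mul_eq_one hd)
          (left_ne_zero_of_mul_eq_one hd')) h2
    obtain ⟨a, rfl⟩ := exists_eq_diag h10' h01
    exact ⟨a, w, hD.symm⟩
  obtain ⟨S, hS, hSmem⟩ := isTorus_diagonal hG hφ
  have hTS : T = S := hT.eq_of_le hS fun t ht => (hSmem t).2 (hTd ⟨t, ht⟩)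
  have hUB : ∀ s, φ (upper s, 1) ∈ B := fun s => hu₂ s ▸ huB _
  refine ⟨n, φ, hφ.regular, hφ.surjective, hUB, fun g => hTS ▸ hSmem g, ?_, ?_⟩
  · intro t a z h
    exact (htri φ hφ hu₂ t _ _ h.symm).2
  · intro b hb
    obtain ⟨⟨A, z⟩, rfl⟩ := hφ.surjective b
    obtain ⟨a, x, rfl⟩ := exists_eq_diag_mul_upper
      (triangular_of_solvable hφ hB.prop.solvable hUB hb)
    exact ⟨a, z, x, by rw [← map_mul]; simp⟩

end AdaptedCover

/-! ### Translations of regular functions -/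

section Translation

variable {K : Type*} [Field K] {G : Type*} [Group G] {X : Type*} [MulAction G X]

variable (K X) in
/-- The translation by `g ∈ G` as an algebra endomorphism of the functions on `X`. -/
def translateHom (g : G) : (X → K) →ₐ[K] (X → K) := pullback K fun x => g⁻¹ • x

omit [Field K] in
theorem translate_mul_apply (g h : G) (f : X → K) :
    translate K (g * h) f = translate K g (translate K h f) := by
  funext x; simp [translate, mul_smul]

omit [Field K] in
@[simp] theorem translate_one (f : X → K) : translate K (1 : G) f = f := by
  funext x; simp [translate]

theorem translate_smul (g : G) (c : K) (f : X → K) :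
    translate K g (c • f) = c • translate K g f := rfl

theorem translate_sub (g : G) (f f' : X → K) :
    translate K g (f - f') = translate K g f - translate K g f' := rfl

theorem translate_mul (g : G) (f f' : X → K) :
    translate K g (f * f') = translate K g f * translate K g f' := rfl

theorem translate_pow (g : G) (f : X → K) (n : ℕ) :
    translate K g (f ^ n) = translate K g f ^ n := rfl

theorem translate_sum {ι : Type*} (g : G) (s : Finset ι) (f : ι → X → K) :
    translate K g (∑ i ∈ s, f i) = ∑ i ∈ s, translate K g (f i) :=
  map_sum (translateHom K X g) f s

omit [Field K] in
theorem translate_injective (g : G) : Function.Injective (translate K g : (X → K) → X → K) := by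
  intro f f' h
  have := congrArg (translate K g⁻¹) h
  rwa [← translate_mul_apply, ← translate_mul_apply, inv_mul_cancel, translate_one,
    translate_one] at this

@[simp] theorem translate_zero (g : G) : translate K g (0 : X → K) = 0 := rfl

variable [RegularFunctions K G] [RegularFunctions K X]

theorem exists_translate_eq_sum (hG : IsLinearAlgebraicGroup K G) (hact : IsRegularAction K G X)
    {f : X → K} (hf : f ∈ coordRing K X) : ∃ (n : ℕ) (a : Fin n → G → K) (b : Fin n → X → K),
      (∀ i, a i ∈ coordRing K G) ∧ (∀ i, b i ∈ coordRing K X) ∧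
      ∀ g, translate K g f = ∑ i, a i g • b i := by
  obtain ⟨n, a, b, ha, hb, h⟩ := exists_sum_mul_of_mem_coordRing_prod (hact f hf)
  refine ⟨n, fun i g => a i g⁻¹, b, fun i => hG.inv_mem (ha i), hb, fun g => ?_⟩
  funext x
  rw [Finset.sum_apply]
  exact h g⁻¹ x

theorem translate_mem (hG : IsLinearAlgebraicGroup K G) (hact : IsRegularAction K G X)
    {f : X → K} (hf : f ∈ coordRing K X) (g : G) : translate K g f ∈ coordRing K X := by
  obtain ⟨n, a, b, -, hb, h⟩ := exists_translate_eq_sum hG hact hf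
  rw [h]
  exact sum_mem fun i _ => Subalgebra.smul_mem _ (hb i) _

/-- Along a regular curve `K → G`, the translates of a regular function are a polynomial curve. -/
theorem exists_translate_curve (hG : IsLinearAlgebraicGroup K G) (hact : IsRegularAction K G X)
    {f : X → K} (hf : f ∈ coordRing K X) {γ : K → G} (hγ : IsRegularMap K γ) :
    ∃ (N : ℕ) (w : ℕ → X → K), (∀ i, w i ∈ coordRing K X) ∧
      ∀ s, translate K (γ s) f = ∑ i ∈ Finset.range N, s ^ i • w i := by
  obtain ⟨n, a, b, ha, hb, h⟩ := exists_translate_eq_sum hG hact hf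
  choose p hp using fun i => exists_polynomial_of_mem_coordRing_affineLine (hγ (a i) (ha i))
  refine ⟨(Finset.univ.sup fun i => (p i).natDegree) + 1, fun j => ∑ i, (p i).coeff j • b i,
    fun j => sum_mem fun i _ => Subalgebra.smul_mem _ (hb i) _, fun s => ?_⟩
  rw [h]
  simp only [Finset.smul_sum]
  rw [Finset.sum_comm]
  refine Finset.sum_congr rfl fun i _ => ?_
  have hpi : a i (γ s) = (p i).eval s := hp i s
  rw [hpi, Polynomial.eval_eq_sum_range' (n := (Finset.univ.sup fun i => (p i).natDegree) + 1)
    (Nat.lt_succ_of_le (Finset.le_sup (f := fun i => (p i).natDegree) (Finset.mem_univ i))),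
    Finset.sum_smul]
  exact Finset.sum_congr rfl fun j _ => by rw [smul_smul, mul_comm]

theorem coeff_eq_of_forall_sum_eq {K V : Type*} [Field K] [Infinite K] [AddCommGroup V]
    [Module K V] (N : ℕ) (v w : ℕ → V)
    (h : ∀ s : K, ∑ i ∈ Finset.range N, s ^ i • v i = ∑ i ∈ Finset.range N, s ^ i • w i) :
    ∀ i < N, v i = w i := fun i hi => by
  have := mem_of_forall_sum_pow_smul_mem (K := K) ⊥ N (fun i => v i - w i) (fun s => by
    rw [Submodule.mem_bot]
    simp only [smul_sub, Finset.sum_sub_distrib, h, sub_self]) i hi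
  rwa [Submodule.mem_bot, sub_eq_zero] at this

/-- The function `f` is a `T`-eigenvector of weight `χ`. -/
def HasWeight {T : Subgroup G} (χ : characterLattice K T) (f : X → K) : Prop :=
  ∀ t : T, translate K (t : G) f = charValue K χ t • f

omit [RegularFunctions K X] in
theorem HasWeight.mul {T : Subgroup G} {χ ψ : characterLattice K T} {f g : X → K}
    (hf : HasWeight χ f) (hg : HasWeight ψ g) : HasWeight (χ + ψ) (f * g) := fun t => by
  rw [translate_mul, hf, hg, charValue_add, smul_mul_smul_comm]

omit [RegularFunctions K X] in
theorem HasWeight.one {T : Subgroup G} : HasWeight (0 : characterLattice K T) (1 : X → K) :=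
  fun t => by simp; rfl

omit [RegularFunctions K X] in
theorem HasWeight.pow {T : Subgroup G} {χ : characterLattice K T} {f : X → K}
    (hf : HasWeight χ f) (n : ℕ) : HasWeight (n • χ) (f ^ n) := by
  induction n with
  | zero => simpa using HasWeight.one
  | succ n ih => rw [succ_nsmul, pow_succ]; exact ih.mul hf

/-- Every regular function is a sum of regular weight vectors. -/
theorem exists_weight_decomposition (hG : IsLinearAlgebraicGroup K G)
    (hact : IsRegularAction K G X) {T : Subgroup G} (hT : IsDiagonalizable K T) {f : X → K}
    (hf : f ∈ coordRing K X) : ∃ (s : Finset (characterLattice K T))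
      (w : characterLattice K T → X → K), (∀ χ, w χ ∈ coordRing K X) ∧
      (∀ χ ∈ s, HasWeight χ (w χ)) ∧ f = ∑ χ ∈ s, w χ := by
  classical
  obtain ⟨n, a, b, ha, hb, h⟩ := exists_translate_eq_sum hG hact hf
  choose c hc using fun i => hT.exists_sum (isRegularMap_val (fun g => g ∈ T) (a i) (ha i))
  let s := Finset.univ.biUnion fun i => (c i).support
  let w : characterLattice K T → X → K := fun χ => ∑ i, c i χ • b i
  have hexp : ∀ t : T, translate K (t : G) f = ∑ χ ∈ s, charValue K χ t • w χ := by
    intro t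
    rw [h]
    simp only [w, Finset.smul_sum]
    rw [Finset.sum_comm]
    refine Finset.sum_congr rfl fun i _ => ?_
    have : a i t = ∑ χ ∈ s, c i χ * charValue K χ t := by
      refine (hc i t).trans (Finset.sum_subset ?_ ?_)
      · exact Finset.subset_biUnion_of_mem (fun i => (c i).support) (Finset.mem_univ i)
      · intro χ _ hχ
        rw [Finsupp.notMem_support_iff.1 hχ, zero_mul]
    rw [this, Finset.sum_smul]
    exact Finset.sum_congr rfl fun χ _ => by rw [smul_smul, mul_comm]
  refine ⟨s, w, fun χ => sum_mem fun i _ => Subalgebra.smul_mem _ (hb i) _, ?_, ?_⟩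
  · intro χ hχ t
    have := mem_of_forall_sum_hom_smul_mem (K := K) ⊥ s charHom charHom_injective.injOn
      (fun χ => translate K (t : G) (w χ) - charValue K χ t • w χ) (fun t' => ?_) χ hχ
    · rwa [Submodule.mem_bot, sub_eq_zero] at this
    · rw [Submodule.mem_bot]
      simp only [smul_sub, Finset.sum_sub_distrib, sub_eq_zero, charHom_apply]
      have h1 := hexp (t * t')
      rw [Subgroup.coe_mul, translate_mul_apply, hexp t', translate_sum] at h1
      refine h1.trans (Finset.sum_congr rfl fun χ _ => ?_)
      rw [charValue_mul, smul_smul, mul_comm]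
  · have := hexp 1
    rw [Subgroup.coe_one, translate_one] at this
    rw [this]
    refine Finset.sum_congr rfl fun χ _ => ?_
    have h1 : charValue K χ (1 : T) = 1 := map_one (charHom χ)
    rw [h1, one_smul]

end Translation

/-! ### Highest-weight vectors and binary forms -/

section HighestWeight

variable {K : Type*} [Field K] {G : Type*} [Group G]
  [RegularFunctions K G] {n : ℕ} {B T : Subgroup G} {α : characterLattice K T}
  {φ : SL2 K × (Fin n → Kˣ) →* G} {X : Type*} [MulAction G X] [RegularFunctions K X]

/-- The matrix `!![a, -1; 1, 0]`. -/
def weylCurve (a : K) : SL2 K := ⟨!![a, -1; 1, 0], by simp [Matrix.det_fin_two]⟩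

@[simp] theorem weylCurve_00 (a : K) : (weylCurve a).1 0 0 = a := rfl
@[simp] theorem weylCurve_01 (a : K) : (weylCurve a).1 0 1 = -1 := rfl
@[simp] theorem weylCurve_10 (a : K) : (weylCurve a).1 1 0 = 1 := rfl
@[simp] theorem weylCurve_11 (a : K) : (weylCurve a).1 1 1 = 0 := rfl

theorem weylCurve_eq (a : Kˣ) :
    weylCurve (a : K) = lower (a : K)⁻¹ * diag a * upper (-(a : K)⁻¹) := by
  apply sl2_ext <;> simp

theorem isRegularMap_lower_one :
    IsRegularMap K (fun s : K => ((lower s, 1) : SL2 K × (Fin n → Kˣ))) := by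
  refine IsRegularMap.prodMk (isRegularMap_sl2_iff.2 fun i j => ?_) (isRegularMap_const _)
  fin_cases i <;> fin_cases j
  · exact Subalgebra.algebraMap_mem _ (1 : K)
  · exact Subalgebra.algebraMap_mem _ (0 : K)
  · exact id_mem_coordRing_affineLine
  · exact Subalgebra.algebraMap_mem _ (1 : K)

theorem isRegularMap_weylCurve_one :
    IsRegularMap K (fun s : K => ((weylCurve s, 1) : SL2 K × (Fin n → Kˣ))) := by
  refine IsRegularMap.prodMk (isRegularMap_sl2_iff.2 fun i j => ?_) (isRegularMap_const _)
  fin_cases i <;> fin_cases j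
  · exact id_mem_coordRing_affineLine
  · exact Subalgebra.algebraMap_mem _ (-1 : K)
  · exact Subalgebra.algebraMap_mem _ (1 : K)
  · exact Subalgebra.algebraMap_mem _ (0 : K)

theorem isRegularMap_diag_one :
    IsRegularMap K (fun x : Fin 1 → Kˣ => ((diag (x 0), 1) : SL2 K × (Fin n → Kˣ))) := by
  refine IsRegularMap.prodMk (isRegularMap_sl2_iff.2 fun i j => ?_) (isRegularMap_const _)
  have h0 := (isRegularMap_units_iff K (fun x : Fin 1 → Kˣ => x 0)).1 (isRegularMap_eval 0)
  fin_cases i <;> fin_cases j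
  · exact h0.1
  · exact Subalgebra.algebraMap_mem _ (0 : K)
  · exact Subalgebra.algebraMap_mem _ (0 : K)
  · simpa using h0.2

namespace IsAdaptedCover

/-- The image of `(diag(a, a⁻¹), z)`, as an element of `T`. -/
def torusElt (h : IsAdaptedCover B T α φ) (a : Kˣ) (z : Fin n → Kˣ) : T :=
  ⟨φ (diag a, z), (h.mem_torus _).2 ⟨a, z, rfl⟩⟩

@[simp] theorem coe_torusElt (h : IsAdaptedCover B T α φ) (a : Kˣ) (z : Fin n → Kˣ) :
    (h.torusElt a z : G) = φ (diag a, z) := rfl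

theorem exists_torusElt (h : IsAdaptedCover B T α φ) (t : T) : ∃ a z, t = h.torusElt a z := by
  obtain ⟨a, z, ht⟩ := (h.mem_torus t).1 t.2
  exact ⟨a, z, Subtype.ext ht⟩

@[simp] theorem root_torusElt (h : IsAdaptedCover B T α φ) (a : Kˣ) (z : Fin n → Kˣ) :
    charValue K α (h.torusElt a z) = (a : K) ^ 2 := h.root _ a z rfl

omit [RegularFunctions K G] in
theorem map_mul_one (φ : SL2 K × (Fin n → Kˣ) →* G) (A A' : SL2 K) :
    φ (A * A', 1) = φ (A, 1) * φ (A', 1) := by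
  rw [← map_mul]; simp

/-- The pairing of a character of `T` with the coroot. -/
theorem exists_pairing (h : IsAdaptedCover B T α φ) (χ : characterLattice K T) :
    ∃ k : ℤ, ∀ a, charValue K χ (h.torusElt a 1) = (a : K) ^ k := by
  let ι : (Fin 1 → Kˣ) →* T :=
    { toFun := fun x => h.torusElt (x 0) 1
      map_one' := Subtype.ext (by
        rw [coe_torusElt, Pi.one_apply, map_one]; exact map_one φ)
      map_mul' := fun x y => Subtype.ext (by
        rw [coe_torusElt, Pi.mul_apply, map_mul]; exact map_mul_one φ _ _) }
  have hι : IsRegularMap K ι := isRegularMap_subtype (h.regular.comp isRegularMap_diag_one)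
  have key : ∀ ψ : characterLattice K (Fin 1 → Kˣ), ∃ k : ℤ, ∀ x,
      charValue K ψ x = (x 0 : K) ^ k := by
    intro ψ
    have hψ : ψ ∈ AddSubgroup.closure (Set.range (coordChar K (m := 1))) := by
      rw [closure_coordChar]; trivial
    induction hψ using AddSubgroup.closure_induction with
    | mem ψ hψ =>
      obtain ⟨i, rfl⟩ := hψ
      exact ⟨1, fun x => by rw [zpow_one, Subsingleton.elim i 0]; rfl⟩
    | zero => exact ⟨0, fun x => by simp⟩
    | add ψ ψ' _ _ hψ hψ' =>
      obtain ⟨k, hk⟩ := hψ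
      obtain ⟨k', hk'⟩ := hψ'
      exact ⟨k + k', fun x => by rw [charValue_add, hk, hk', zpow_add₀ (Units.ne_zero _)]⟩
    | neg ψ _ hψ =>
      obtain ⟨k, hk⟩ := hψ
      exact ⟨-k, fun x => by rw [charValue_neg, hk, zpow_neg]⟩
  obtain ⟨k, hk⟩ := key (charPullback ι hι χ)
  exact ⟨k, fun a => hk fun _ => a⟩

/-- The function `f` is invariant under the unipotent radical of `B`. -/
def UInvariant (_ : IsAdaptedCover B T α φ) (f : X → K) : Prop :=
  ∀ s, translate K (φ (upper s, 1)) f = f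

/-- The orbit map of a highest-weight vector `v`, as a function of the first column `(a, c)` of a
matrix in `SL₂`, is a binary form of degree `k`, the pairing of the weight with the coroot. -/
theorem exists_binary_form [CharZero K] (h : IsAdaptedCover B T α φ)
    (hG : IsLinearAlgebraicGroup K G)
    (hact : IsRegularAction K G X) {χ : characterLattice K T} {v : X → K}
    (hv : v ∈ coordRing K X) (hv0 : v ≠ 0) (hU : h.UInvariant v) (hχ : HasWeight χ v) :
    ∃ (k : ℕ) (w : ℕ → X → K), (∀ a, charValue K χ (h.torusElt a 1) = (a : K) ^ k) ∧
      (∀ i, w i ∈ coordRing K X) ∧ w 0 = v ∧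
      ∀ A : SL2 K, translate K (φ (A, 1)) v =
        ∑ i ∈ Finset.range (k + 1), (A.1 0 0 ^ (k - i) * A.1 1 0 ^ i) • w i := by
  obtain ⟨k, hk⟩ := h.exists_pairing χ
  obtain ⟨N, w', hw', hlow⟩ := exists_translate_curve hG hact hv
    (h.regular.comp isRegularMap_lower_one)
  obtain ⟨N₂, w₂, -, hweyl⟩ := exists_translate_curve hG hact hv
    (h.regular.comp isRegularMap_weylCurve_one)
  have hdiag : ∀ a, translate K (φ (diag a, 1)) v = (a : K) ^ k • v := fun a => by
    rw [← hk]; exact hχ (h.torusElt a 1)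
  let w : ℕ → X → K := fun i => if i < N then w' i else 0
  have hw : ∀ i, w i ∈ coordRing K X := fun i => by
    dsimp only [w]; split_ifs
    · exact hw' i
    · exact zero_mem _
  have hlow' : ∀ M, N ≤ M → ∀ y, translate K (φ (lower y, 1)) v =
      ∑ i ∈ Finset.range M, y ^ i • w i := by
    intro M hM y
    rw [hlow, ← Finset.sum_subset (Finset.range_mono hM)]
    · refine Finset.sum_congr rfl fun i hi => ?_
      rw [show w i = w' i from if_pos (Finset.mem_range.1 hi)]
    · intro i _ hi
      rw [show w i = 0 from if_neg (by simpa using hi), smul_zero]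
  have hweyl' : ∀ a : Kˣ, translate K (φ (weylCurve (a : K), 1)) v =
      (a : K) ^ k • translate K (φ (lower (a : K)⁻¹, 1)) v := by
    intro a
    rw [weylCurve_eq, map_mul_one, map_mul_one, translate_mul_apply, hU, translate_mul_apply,
      hdiag, translate_smul]
  -- compare the two expansions of the orbit map along `weylCurve`, which are polynomials in `a`
  -- up to a power of `a`
  obtain ⟨M, hM⟩ : ∃ M : ℕ, (0 : ℤ) ≤ k + M ∧ (N : ℤ) ≤ k + M :=
    ⟨N + k.natAbs, by omega, by omega⟩
  obtain ⟨L, hL⟩ := Int.eq_ofNat_of_zero_le hM.1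
  have hcoef : ∀ x, ∀ i ≤ L, w i x = if M ≤ L - i then
      ∑ j ∈ Finset.range N₂, (if L - i - M = j then w₂ j x else 0) else 0 := by
    intro x
    let p : Polynomial K := ∑ j ∈ Finset.range N₂, Polynomial.C (w₂ j x) * Polynomial.X ^ j
    let q : Polynomial K :=
      ∑ i ∈ Finset.range (L + 1), Polynomial.C (w i x) * Polynomial.X ^ (L - i)
    have hpq : p * Polynomial.X ^ M = q := by
      refine Polynomial.eq_of_infinite_eval_eq _ _ ((Set.finite_singleton (0 : K)).infinite_compl.mono ?_)
      intro a₀ ha₀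
      lift a₀ to Kˣ using isUnit_iff_ne_zero.2 ha₀ with a
      have h1 := congrFun (hweyl a) x
      have h2 : translate K (φ (weylCurve (a : K), 1)) v x = _ := congrFun (hweyl' a) x
      rw [h2, hlow' (L + 1) (by omega)] at h1
      simp only [Finset.sum_apply, Pi.smul_apply, smul_eq_mul] at h1
      simp only [Set.mem_ofPred_eq, p, q, Polynomial.eval_mul, Polynomial.eval_finsetSum,
        Polynomial.eval_C, Polynomial.eval_pow, Polynomial.eval_X]
      have h3 : ∑ j ∈ Finset.range N₂, w₂ j x * (a : K) ^ j =
          ∑ j ∈ Finset.range N₂, (a : K) ^ j * w₂ j x :=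
        Finset.sum_congr rfl fun j _ => mul_comm _ _
      rw [h3, ← h1, Finset.mul_sum, Finset.sum_mul]
      refine Finset.sum_congr rfl fun i hi => ?_
      have hi' : i ≤ L := Nat.lt_succ_iff.1 (Finset.mem_range.1 hi)
      have ha := a.ne_zero
      rw [pow_sub₀ _ ha hi', ← zpow_natCast (a : K) L, show ((L : ℕ) : ℤ) = k + M from hL.symm,
        zpow_add₀ ha, zpow_natCast, inv_pow]
      ring
    intro i hi
    have h1 := congrArg (fun r : Polynomial K => r.coeff (L - i)) hpq
    simp only [Polynomial.coeff_mul_X_pow'] at h1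
    simp only [p, q, Polynomial.finsetSum_coeff, Polynomial.coeff_C_mul_X_pow] at h1
    rw [h1, Finset.sum_eq_single i]
    · simp
    · intro j hj hji
      rw [if_neg]
      have := Finset.mem_range.1 hj
      omega
    · intro hi'
      exact absurd (Finset.mem_range.2 (Nat.lt_succ_of_le hi)) hi'
  have hbig : ∀ i : ℕ, k < i → w i = 0 := by
    intro i hi
    by_cases hiL : i ≤ L
    · funext x
      rw [hcoef x i hiL, if_neg (by omega)]; rfl
    · exact if_neg (by omega)
  have hw0 : w 0 = v := by
    have h1 := hlow' (N + 1) (by omega) 0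
    rw [lower_zero, show ((1, 1) : SL2 K × (Fin n → Kˣ)) = 1 from rfl, map_one φ, translate_one,
      Finset.sum_eq_single 0 (by intro i _ hi; simp [hi]) (by simp)] at h1
    simpa using h1.symm
  have hk0 : 0 ≤ k := by
    by_contra hneg
    exact hv0 (hw0 ▸ hbig 0 (by simpa using hneg))
  obtain ⟨k, rfl⟩ := Int.eq_ofNat_of_zero_le hk0
  refine ⟨k, w, fun a => by rw [hk, zpow_natCast], hw, hw0, fun A => ?_⟩
  have hlow'' : ∀ y, translate K (φ (lower y, 1)) v =
      ∑ i ∈ Finset.range (k + 1), y ^ i • w i := by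
    intro y
    rw [hlow' (max N (k + 1)) (le_max_left _ _)]
    refine (Finset.sum_subset (Finset.range_mono (le_max_right _ _)) fun i _ hi => ?_).symm
    rw [hbig i (by simp at hi; omega), smul_zero]
  have hd := sl2_det A
  by_cases hA : A.1 0 0 = 0
  · -- the value at `weylCurve 0` is the last coefficient
    rw [hA, zero_mul, zero_sub] at hd
    have hc : A.1 1 0 ≠ 0 := by
      intro hc
      rw [hc] at hd
      simp at hd
    have hAeq : A = weylCurve 0 * diag (Units.mk0 _ hc) * upper (A.1 1 1 / A.1 1 0) := by
      apply sl2_ext <;> simp [hA]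
      · exact eq_neg_of_add_eq_zero_left (by field_simp; linear_combination -hd)
      · field_simp
    have hweyl0 : translate K (φ (weylCurve (0 : K), 1)) v = w k := by
      refine (hweyl 0).trans ?_
      funext x
      rw [hcoef x k (by omega), if_pos (by omega), Finset.sum_apply]
      refine Finset.sum_congr rfl fun j _ => ?_
      have : L - k - M = 0 := by omega
      rw [this]
      rcases Nat.eq_zero_or_pos j with rfl | hj
      · simp
      · simp [hj.ne', hj.ne]
    rw [hAeq, map_mul_one, map_mul_one, translate_mul_apply, hU, translate_mul_apply, hdiag,
      translate_smul, hweyl0, Finset.sum_eq_single k]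
    · simp
    · intro i hi hik
      have : k - i ≠ 0 := by have := Finset.mem_range.1 hi; omega
      simp [this]
    · simp
  · have hAeq : A = lower (A.1 1 0 / A.1 0 0) * diag (Units.mk0 _ hA) *
        upper (A.1 0 1 / A.1 0 0) := by
      apply sl2_ext <;> simp
      · field_simp
      · field_simp
      · field_simp
        linear_combination hd
    conv_lhs => rw [hAeq, map_mul_one, map_mul_one, translate_mul_apply, hU, translate_mul_apply,
      hdiag, translate_smul, hlow'', Finset.smul_sum]
    refine Finset.sum_congr rfl fun i hi => ?_
    rw [smul_smul]
    congr 1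
    have hi' : i ≤ k := Nat.lt_succ_iff.1 (Finset.mem_range.1 hi)
    rw [Units.val_mk0, zpow_natCast, div_pow, pow_sub₀ _ hA hi']
    field_simp

end IsAdaptedCover
end HighestWeight

/-! ### Simple modules and the weight monoid -/

section SimpleModules

variable {K : Type*} [Field K] {G : Type*} [Group G]
  [RegularFunctions K G] {n : ℕ} {B T : Subgroup G} {α : characterLattice K T}
  {φ : SL2 K × (Fin n → Kˣ) →* G} {X : Type*} [MulAction G X] [RegularFunctions K X]

namespace IsAdaptedCover

theorem torus_mul_lower (h : IsAdaptedCover B T α φ) (t : T) (y : K) :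
    (t : G) * φ (lower y, 1) = φ (lower ((charValue K α t)⁻¹ * y), 1) * t := by
  obtain ⟨a, z, rfl⟩ := h.exists_torusElt t
  rw [root_torusElt, coe_torusElt, ← map_mul, ← map_mul, ← diag_lower_diag_inv]
  simp

theorem torus_mul_upper (h : IsAdaptedCover B T α φ) (t : T) (y : K) :
    (t : G) * φ (upper y, 1) = φ (upper (charValue K α t * y), 1) * t := by
  obtain ⟨a, z, rfl⟩ := h.exists_torusElt t
  rw [root_torusElt, coe_torusElt, ← map_mul, ← map_mul, ← diag_upper_diag_inv]
  simp

theorem nsmul_root_injective [CharZero K] (h : IsAdaptedCover B T α φ) {i j : ℕ}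
    (hij : i • α = j • α) : i = j := by
  have h1 := congrArg (fun χ => charValue K χ (h.torusElt (Units.mk0 2 two_ne_zero) 1)) hij
  simp only [charValue_nsmul, root_torusElt, Units.val_mk0, ← pow_mul] at h1
  have h2 : (2 : ℕ) ^ (2 * i) = 2 ^ (2 * j) := by exact_mod_cast h1
  have := Nat.pow_right_injective le_rfl h2
  omega

omit [RegularFunctions K X] in
/-- The unipotent group acts on the coefficients of the orbit map of a highest-weight vector as on
binary forms. -/
theorem upper_smul_coeff [CharZero K] (_ : IsAdaptedCover B T α φ) {v : X → K} {k : ℕ}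
    {w : ℕ → X → K} (hform : ∀ A : SL2 K, translate K (φ (A, 1)) v =
      ∑ i ∈ Finset.range (k + 1), (A.1 0 0 ^ (k - i) * A.1 1 0 ^ i) • w i) {i : ℕ} (hi : i ≤ k)
    (x : K) : translate K (φ (upper x, 1)) (w i) =
      ∑ j ∈ Finset.range (i + 1), (((k - j).choose (i - j) : K) * x ^ (i - j)) • w j := by
  refine coeff_eq_of_forall_sum_eq (K := K) (k + 1)
    (fun i => translate K (φ (upper x, 1)) (w i)) (fun i => ∑ j ∈ Finset.range (i + 1),
      (((k - j).choose (i - j) : K) * x ^ (i - j)) • w j) (fun y => ?_) i (by omega)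
  have h1 : translate K (φ (lower y, 1)) v = ∑ i ∈ Finset.range (k + 1), y ^ i • w i := by
    simpa using hform (lower y)
  have h2 := hform (upper x * lower y)
  rw [map_mul_one, translate_mul_apply, h1, translate_sum] at h2
  refine h2.trans ?_
  have h00 : (upper x * lower y).1 0 0 = x * y + 1 := by simp [add_comm]
  have h10 : (upper x * lower y).1 1 0 = y := by simp
  rw [h00, h10]
  simp only [Finset.smul_sum, smul_smul]
  have h3 : ∀ j ∈ Finset.range (k + 1), ((x * y + 1) ^ (k - j) * y ^ j) • w j =
      ∑ l ∈ Finset.range (k + 1 - j), (y ^ (j + l) * (((k - j).choose l : K) * x ^ l)) • w j := by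
    intro j hj
    have hj' := Finset.mem_range.1 hj
    rw [add_pow, Finset.sum_mul, Finset.sum_smul, show k - j + 1 = k + 1 - j by omega]
    refine Finset.sum_congr rfl fun l _ => ?_
    congr 1
    rw [mul_pow, one_pow, pow_add]
    ring
  rw [Finset.sum_congr rfl h3,
    ← Finset.sum_range_diag_flip (k + 1) fun j l =>
      (y ^ (j + l) * (((k - j).choose l : K) * x ^ l)) • w j]
  refine Finset.sum_congr rfl fun i _ => Finset.sum_congr rfl fun j hj => ?_
  rw [Nat.add_sub_cancel' (Nat.lt_succ_iff.1 (Finset.mem_range.1 hj))]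

omit [RegularFunctions K X] in
theorem weight_coeff [CharZero K] (h : IsAdaptedCover B T α φ) {χ : characterLattice K T}
    {v : X → K} (hχ : HasWeight χ v) {k : ℕ}
    {w : ℕ → X → K} (hform : ∀ A : SL2 K, translate K (φ (A, 1)) v =
      ∑ i ∈ Finset.range (k + 1), (A.1 0 0 ^ (k - i) * A.1 1 0 ^ i) • w i) {i : ℕ} (hi : i ≤ k) :
    HasWeight (χ - i • α) (w i) := by
  intro t
  refine coeff_eq_of_forall_sum_eq (K := K) (k + 1) (fun i => translate K (t : G) (w i))
    (fun i => charValue K (χ - i • α) t • w i) (fun y => ?_) i (by omega)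
  have h1 : ∀ y, translate K (φ (lower y, 1)) v = ∑ i ∈ Finset.range (k + 1), y ^ i • w i :=
    fun y => by simpa using hform (lower y)
  have h2 : translate K (t : G) (translate K (φ (lower y, 1)) v) =
      translate K (φ (lower ((charValue K α t)⁻¹ * y), 1)) (translate K (t : G) v) := by
    rw [← translate_mul_apply, ← translate_mul_apply, h.torus_mul_lower]
  rw [hχ, translate_smul, h1, h1, translate_sum, Finset.smul_sum] at h2
  refine h2.trans (Finset.sum_congr rfl fun i _ => ?_)
  rw [smul_smul, smul_smul, sub_eq_add_neg, charValue_add, charValue_neg, charValue_nsmul,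
    mul_pow, inv_pow]
  congr 1
  ring

/-- A regular highest-weight vector generates a simple module. -/
theorem mem_weightMonoid_of_uInvariant [CharZero K] (h : IsAdaptedCover B T α φ)
    (hG : IsLinearAlgebraicGroup K G) (hact : IsRegularAction K G X) {χ : characterLattice K T}
    {v : X → K} (hv : v ∈ coordRing K X) (hv0 : v ≠ 0) (hU : h.UInvariant v)
    (hχ : HasWeight χ v) : χ ∈ weightMonoid K B T X := by
  obtain ⟨k, w, -, hw, hw0, hform⟩ := h.exists_binary_form hG hact hv hv0 hU hχ
  let V : Submodule K (X → K) := Submodule.span K (Set.range fun g : G => translate K g v)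
  have hvV : v ∈ V := Submodule.subset_span ⟨1, translate_one v⟩
  have hVw : V ≤ Submodule.span K (w '' (Finset.range (k + 1) : Set ℕ)) := by
    refine Submodule.span_le.2 ?_
    rintro _ ⟨g, rfl⟩
    obtain ⟨⟨A, z⟩, rfl⟩ := h.surjective g
    have hAz : φ (A, z) = φ (A, 1) * φ (diag 1, z) := by rw [← map_mul]; simp
    have hz := hχ (h.torusElt 1 z)
    rw [coe_torusElt] at hz
    change translate K (φ (A, z)) v ∈ _
    rw [hAz, translate_mul_apply, hz, translate_smul, hform]
    exact Submodule.smul_mem _ _ (sum_mem fun i hi => Submodule.smul_mem _ _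
      (Submodule.subset_span ⟨i, hi, rfl⟩))
  refine ⟨V, ⟨?_, ?_, ?_, ?_⟩, v, hvV, hv0, ?_, hχ⟩
  · refine Submodule.span_le.2 ?_
    rintro _ ⟨g, rfl⟩
    exact translate_mem hG hact hv g
  · intro g f hf
    have h1 := Submodule.mem_map_of_mem (f := (translateHom K X g).toLinearMap) hf
    rw [Submodule.map_span] at h1
    refine Submodule.span_mono ?_ h1
    rintro _ ⟨_, ⟨g', rfl⟩, rfl⟩
    exact ⟨g * g', translate_mul_apply g g' v⟩
  · exact fun hV => hv0 ((Submodule.eq_bot_iff V).1 hV v hvV)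
  · intro W hW hWV
    rw [or_iff_not_imp_left]
    intro hWne
    obtain ⟨f, hfW, hf0⟩ := Submodule.exists_mem_ne_zero_of_ne_bot hWne
    obtain ⟨c, hc⟩ := (Submodule.mem_span_image_finset_iff_exists_fun' K).1 (hVw (hWV hfW))
    -- a nonzero weight component of `f` lies in `W`
    have hcomp : ∀ i ∈ Finset.range (k + 1), c i • w i ∈ W := by
      refine mem_of_forall_sum_hom_smul_mem (M := T) W _ (fun i => charHom (χ - i • α))
        (fun i _ j _ hij => h.nsmul_root_injective (sub_right_injective (charHom_injective hij)))
        (fun i => c i • w i) (fun t => ?_)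
      convert hW t f hfW using 1
      rw [← hc, translate_sum]
      refine Finset.sum_congr rfl fun i hi => ?_
      rw [translate_smul, h.weight_coeff hχ hform (Nat.lt_succ_iff.1 (Finset.mem_range.1 hi)) t,
        smul_comm, charHom_apply]
    obtain ⟨m, hm, hcm⟩ : ∃ m ∈ Finset.range (k + 1), c m • w m ≠ 0 := by
      by_contra! hall
      exact hf0 (hc ▸ Finset.sum_eq_zero hall)
    have hmk : m ≤ k := Nat.lt_succ_iff.1 (Finset.mem_range.1 hm)
    have hwm : w m ∈ W := (Submodule.smul_mem_iff W (left_ne_zero_of_smul hcm)).1 (hcomp m hm)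
    -- the unipotent group carries it to a vector with a nonzero highest-weight component
    have hv' := mem_of_forall_sum_pow_smul_mem (K := K) W (m + 1)
      (fun l => ((k - (m - l)).choose l : K) • w (m - l)) (fun x => by
        have h1 := hW (φ (upper x, 1)) _ hwm
        rw [h.upper_smul_coeff hform hmk, ← Finset.sum_range_reflect] at h1
        convert h1 using 1
        refine Finset.sum_congr rfl fun l hl => ?_
        have hl' : l ≤ m := Nat.lt_succ_iff.1 (Finset.mem_range.1 hl)
        rw [smul_smul, show m + 1 - 1 - l = m - l by omega, show m - (m - l) = l by omega,
          mul_comm]) m (by omega)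
    simp only [Nat.sub_self, Nat.sub_zero] at hv'
    rw [hw0, Submodule.smul_mem_iff W (by exact_mod_cast (Nat.choose_pos hmk).ne')] at hv'
    refine le_antisymm hWV (Submodule.span_le.2 ?_)
    rintro _ ⟨g, rfl⟩
    exact hW g v hv'
  · intro b hb
    obtain ⟨a, z, x, rfl⟩ := h.borel b hb
    refine ⟨charValue K χ (h.torusElt a z), ?_⟩
    rw [translate_mul_apply, hU]
    exact hχ (h.torusElt a z)

/-- A weight of the weight monoid is the weight of a regular function that is invariant under the
unipotent radical of `B`. -/
theorem exists_uInvariant_of_mem_weightMonoid [CharZero K] [IsAlgClosed K]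
    (h : IsAdaptedCover B T α φ) {χ : characterLattice K T}
    (hχ : χ ∈ weightMonoid K B T X) :
    ∃ v ∈ coordRing K X, v ≠ 0 ∧ h.UInvariant v ∧ HasWeight χ v := by
  obtain ⟨V, hV, v, hvV, hv⟩ := hχ
  refine ⟨v, hV.le_coordRing hvV, hv.ne_zero, fun s => ?_, hv.weight⟩
  have hv0 := hv.ne_zero
  obtain ⟨c, hc⟩ := hv.line_stable _ (h.upper_mem s)
  have hc0 : c ≠ 0 := by
    rintro rfl
    rw [zero_smul, ← translate_zero (φ (upper s, 1))] at hc
    exact hv0 (translate_injective _ hc)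
  obtain ⟨r, hr⟩ := units_exists_pow_eq (K := K) (Units.mk0 2 two_ne_zero) two_ne_zero
  have hr' : (r : K) ^ 2 = 2 := by rw [← Units.val_pow_eq_pow_val, hr]; rfl
  -- conjugating by an element of `T` on which `α` is `2` shows that `c = c ^ 2`
  have h1 : translate K (h.torusElt r 1 : G) (translate K (φ (upper s, 1)) v) =
      translate K (φ (upper (2 * s), 1)) (translate K (h.torusElt r 1 : G) v) := by
    rw [← translate_mul_apply, ← translate_mul_apply, h.torus_mul_upper, root_torusElt, hr']
  rw [two_mul, upper_add, map_mul_one, translate_mul_apply, hv.weight, hc, translate_smul,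
    hv.weight, translate_smul, translate_smul, hc, translate_smul, hc, smul_smul, smul_smul,
    smul_smul] at h1
  have h2 := smul_left_injective K hv0 h1
  have hχ0 := charValue_ne_zero χ (h.torusElt r 1)
  have hc1 : c = 1 := by
    have h3 : (c * charValue K χ (h.torusElt r 1)) * c =
        (c * charValue K χ (h.torusElt r 1)) * 1 := by
      linear_combination -h2
    exact mul_left_cancel₀ (mul_ne_zero hc0 hχ0) h3
  rw [hc, hc1, one_smul]

omit [RegularFunctions K X] in
/-- The leading coefficient of the orbit map of the unipotent group is invariant under this group,
and of weight shifted by a multiple of the root. -/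
theorem leadingCoeff_uInvariant [CharZero K] (h : IsAdaptedCover B T α φ)
    {χ : characterLattice K T} {f : X → K} (hχ : HasWeight χ f) {m : ℕ} {w : ℕ → X → K}
    (hw : ∀ s, translate K (φ (upper s, 1)) f = ∑ i ∈ Finset.range (m + 1), s ^ i • w i) :
    h.UInvariant (w m) ∧ HasWeight (χ + m • α) (w m) := by
  constructor
  · intro y
    have h1 := coeff_eq_of_forall_sum_eq (K := K) (m + 1)
      (fun i => translate K (φ (upper y, 1)) (w i))
      (fun j => ∑ i ∈ Finset.range (m + 1), (y ^ (i - j) * (i.choose j : K)) • w i)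
      (fun s => ?_) m (by omega)
    · refine h1.trans ?_
      rw [Finset.sum_range_succ, Finset.sum_eq_zero]
      · simp
      · intro i hi
        rw [Nat.choose_eq_zero_of_lt (Finset.mem_range.1 hi)]
        simp
    · have h2 : translate K (φ (upper y, 1)) (translate K (φ (upper s, 1)) f) =
          translate K (φ (upper (s + y), 1)) f := by
        rw [← translate_mul_apply, ← map_mul_one, ← upper_add, add_comm]
      rw [hw, hw, translate_sum] at h2
      refine h2.trans ?_
      simp only [Finset.smul_sum]
      rw [Finset.sum_comm]
      refine Finset.sum_congr rfl fun i hi => ?_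
      rw [add_pow, Finset.sum_smul]
      have hi' : i + 1 ≤ m + 1 := Finset.mem_range.1 hi
      rw [← Finset.sum_subset (Finset.range_mono hi')]
      · exact Finset.sum_congr rfl fun j _ => by rw [smul_smul, mul_assoc]
      · intro j _ hj
        rw [Nat.choose_eq_zero_of_lt (by simpa using hj)]
        simp
  · intro t
    refine coeff_eq_of_forall_sum_eq (K := K) (m + 1) (fun i => translate K (t : G) (w i))
      (fun i => charValue K (χ + i • α) t • w i) (fun y => ?_) m (by omega)
    have h2 : translate K (t : G) (translate K (φ (upper y, 1)) f) =
        translate K (φ (upper (charValue K α t * y), 1)) (translate K (t : G) f) := by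
      rw [← translate_mul_apply, ← translate_mul_apply, h.torus_mul_upper]
    rw [hχ, translate_smul, hw, hw, translate_sum, Finset.smul_sum] at h2
    refine h2.trans (Finset.sum_congr rfl fun i _ => ?_)
    rw [smul_smul, smul_smul, charValue_add, charValue_nsmul, mul_pow]
    congr 1
    ring

end IsAdaptedCover
end SimpleModules

/-! ### Weight spaces and open orbits of tori -/

section Irreducible

variable {K : Type*} [Field K] {X : Type*} [RegularFunctions K X]

theorem exists_ne_zero_of_isOpen (hX : @IrreducibleSpace X (zariski K X)) {f : X → K}
    (hf : f ∈ coordRing K X) (hf0 : f ≠ 0) {U : Set X} (hU : IsOpen[zariski K X] U)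
    (hU' : U.Nonempty) : ∃ x ∈ U, f x ≠ 0 := by
  let _ := zariski K X
  have hne : {x | f x ≠ 0}.Nonempty := by
    obtain ⟨x, hx⟩ := Function.ne_iff.1 hf0
    exact ⟨x, hx⟩
  obtain ⟨x, hx, hx'⟩ := nonempty_preirreducible_inter hU (isOpen_ne_zero hf) hU' hne
  exact ⟨x, hx, hx'⟩

theorem mul_ne_zero_of_irreducible (hX : @IrreducibleSpace X (zariski K X)) {f g : X → K}
    (hf : f ∈ coordRing K X) (hg : g ∈ coordRing K X) (hf0 : f ≠ 0) (hg0 : g ≠ 0) :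
    f * g ≠ 0 := by
  obtain ⟨x, hx⟩ := Function.ne_iff.1 hg0
  obtain ⟨y, hy, hy'⟩ := exists_ne_zero_of_isOpen hX hf hf0 (isOpen_ne_zero hg) ⟨x, hx⟩
  exact Function.ne_iff.2 ⟨y, mul_ne_zero hy' hy⟩

theorem pow_ne_zero_of_irreducible (hX : @IrreducibleSpace X (zariski K X)) {f : X → K}
    (hf : f ∈ coordRing K X) (hf0 : f ≠ 0) (m : ℕ) : f ^ m ≠ 0 := by
  induction m with
  | zero =>
    obtain ⟨x, -⟩ := Function.ne_iff.1 hf0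
    rw [pow_zero]
    exact Function.ne_iff.2 ⟨x, one_ne_zero⟩
  | succ m ih => rw [pow_succ]; exact mul_ne_zero_of_irreducible hX (pow_mem hf m) hf ih hf0

theorem prod_ne_zero_of_irreducible (hX : @IrreducibleSpace X (zariski K X)) {ι : Type*}
    (s : Finset ι) {f : ι → X → K} (hf : ∀ i ∈ s, f i ∈ coordRing K X)
    (hf0 : ∀ i ∈ s, f i ≠ 0) : ∏ i ∈ s, f i ≠ 0 := by
  classical
  induction s using Finset.induction_on with
  | empty =>
    let _ := zariski K X
    obtain ⟨x⟩ := hX.toNonempty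
    rw [Finset.prod_empty]
    exact Function.ne_iff.2 ⟨x, one_ne_zero⟩
  | insert i s hi ih =>
    rw [Finset.prod_insert hi]
    simp only [Finset.forall_mem_insert] at hf hf0
    exact mul_ne_zero_of_irreducible hX hf.1 (prod_mem hf.2) hf0.1 (ih hf.2 hf0.2)

variable {G : Type*} [Group G] [MulAction G X]

/-- A regular semi-invariant that vanishes at a point of an open orbit is zero. -/
theorem eq_zero_of_semiInvariant (hX : @IrreducibleSpace X (zariski K X)) {H : Subgroup G} {x : X}
    (ho : IsOpen[zariski K X] (MulAction.orbit H x)) {f : X → K} (hf : f ∈ coordRing K X)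
    (hsemi : ∀ g ∈ H, ∃ c : K, translate K g f = c • f) (hfx : f x = 0) : f = 0 := by
  by_contra hf0
  obtain ⟨_, ⟨g, rfl⟩, hy⟩ := exists_ne_zero_of_isOpen hX hf hf0 ho ⟨x, MulAction.mem_orbit_self x⟩
  obtain ⟨c, hc⟩ := hsemi (g : G)⁻¹ (inv_mem g.2)
  have h1 := congrFun hc x
  rw [Pi.smul_apply, hfx, smul_zero] at h1
  simp only [translate, inv_inv] at h1
  exact hy h1

variable [RegularFunctions K G]

/-- Weight vectors of the same weight are proportional if `T` has an open orbit. -/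
theorem exists_eq_smul_of_hasOpenOrbit (hX : @IrreducibleSpace X (zariski K X)) {T : Subgroup G}
    (hT : HasOpenOrbit K T X) {χ : characterLattice K T} {f g : X → K} (hf : f ∈ coordRing K X)
    (hg : g ∈ coordRing K X) (hfχ : HasWeight χ f) (hgχ : HasWeight χ g) (hg0 : g ≠ 0) :
    ∃ c : K, f = c • g := by
  obtain ⟨x, hx⟩ := hT
  have hgx : g x ≠ 0 := fun h =>
    hg0 (eq_zero_of_semiInvariant hX hx hg (fun t ht => ⟨_, hgχ ⟨t, ht⟩⟩) h)
  refine ⟨f x / g x, sub_eq_zero.1 (eq_zero_of_semiInvariant hX hx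
    (sub_mem hf (Subalgebra.smul_mem _ hg _)) (fun t ht => ⟨charValue K χ ⟨t, ht⟩, ?_⟩) ?_)⟩
  · rw [translate_sub, translate_smul, hfχ ⟨t, ht⟩, hgχ ⟨t, ht⟩, smul_sub, smul_comm]
  · simp [hgx]

/-- If the weight spaces of `K[X]` are at most one-dimensional, then `T` has an open orbit: the
points where the homogeneous generators of `K[X]` do not vanish form a single orbit, because such
points differ by a homomorphism from the lattice of weights to `Kˣ`, which extends to `𝔛(T)` and
hence is given by an element of `T`. -/
theorem hasOpenOrbit_of_multiplicityFree [IsAlgClosed K] (hG : IsLinearAlgebraicGroup K G)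
    (hX : IsAffineVariety K X) (hact : IsRegularAction K G X)
    (hirr : @IrreducibleSpace X (zariski K X)) {T : Subgroup G} (hT : IsDiagonalizable K T)
    (hT' : SeparatesDual K T)
    (hmf : ∀ (χ : characterLattice K T), ∀ f ∈ coordRing K X, ∀ g ∈ coordRing K X,
      HasWeight χ f → HasWeight χ g → g ≠ 0 → ∃ c : K, f = c • g) : HasOpenOrbit K T X := by
  classical
  obtain ⟨S, hS⟩ := hX.fg
  have hSR : ∀ f ∈ S, f ∈ coordRing K X := fun f hf => hS ▸ Algebra.subset_adjoin hf
  choose! s w hw hwχ hsum using fun f (hf : f ∈ S) =>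
    exists_weight_decomposition hG hact hT (hSR f hf)
  -- finitely many nonzero weight vectors generating `K[X]`
  let F : Finset (characterLattice K T × (X → K)) :=
    (S.biUnion fun f => (s f).image fun χ => (χ, w f χ)).filter fun p => p.2 ≠ 0
  have hF : ∀ p ∈ F, p.2 ∈ coordRing K X ∧ p.2 ≠ 0 ∧ HasWeight p.1 p.2 := by
    intro p hp
    obtain ⟨hp, hp0⟩ := Finset.mem_filter.1 hp
    obtain ⟨f, hf, hp⟩ := Finset.mem_biUnion.1 hp
    obtain ⟨χ, hχ, rfl⟩ := Finset.mem_image.1 hp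
    exact ⟨hw f hf χ, hp0, hwχ f hf χ hχ⟩
  have hgen : coordRing K X ≤ Algebra.adjoin K 
      (Prod.snd '' (F : Set (characterLattice K T × (X → K)))) := by
    rw [← hS]
    refine Algebra.adjoin_le fun f hf => ?_
    rw [hsum f hf]
    refine sum_mem fun χ hχ => ?_
    by_cases h0 : w f χ = 0
    · rw [h0]; exact zero_mem _
    · refine Algebra.subset_adjoin ⟨(χ, w f χ), ?_, rfl⟩
      exact Finset.mem_filter.2 ⟨Finset.mem_biUnion.2 ⟨f, hf, Finset.mem_image.2 ⟨χ, hχ, rfl⟩⟩, h0⟩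
  let P : X → K := ∏ p ∈ F, p.2
  have hPR : P ∈ coordRing K X := prod_mem fun p hp => (hF p hp).1
  have hP0 : P ≠ 0 := prod_ne_zero_of_irreducible hirr F (fun p hp => (hF p hp).1)
    fun p hp => (hF p hp).2.1
  have hPne : ∀ x, P x ≠ 0 ↔ ∀ p ∈ F, p.2 x ≠ 0 := fun x => by
    simp only [P, Finset.prod_apply, Finset.prod_ne_zero_iff]
  obtain ⟨x₀, hx₀⟩ := Function.ne_iff.1 hP0
  refine ⟨x₀, ?_⟩
  convert isOpen_ne_zero hPR
  ext x
  rw [Set.mem_ofPred_eq]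
  have hx₀' := (hPne x₀).1 hx₀
  constructor
  · rintro ⟨t, rfl⟩
    refine (hPne _).2 fun p hp => ?_
    have h1 := congrFun ((hF p hp).2.2 t⁻¹) x₀
    have h2 : p.2 ((t : G) • x₀) = charValue K p.1 t⁻¹ • p.2 x₀ := by
      simpa [translate] using h1
    exact h2 ▸ mul_ne_zero (charValue_ne_zero _ _) (hx₀' p hp)
  · intro hx
    have hx' := (hPne x).1 hx
    let r : F → Kˣ := fun p => Units.mk0 _ (hx₀' p.1 p.2) / Units.mk0 _ (hx' p.1 p.2)
    have hr : ∀ p : F, (r p : K) * p.1.2 x = p.1.2 x₀ := fun p => by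
      simp [r, hx' p.1 p.2]
    obtain ⟨θ, hθ⟩ := exists_extension_units (K := K)
      (Fintype.linearCombination ℤ (fun p : F => p.1.1)).toAddMonoidHom
      (Fintype.linearCombination ℤ (fun p : F => Additive.ofMul (r p))).toAddMonoidHom (by
        intro m hm
        simp only [LinearMap.toAddMonoidHom_coe, Fintype.linearCombination_apply] at hm ⊢
        -- two monomials in the generators that have the same weight are proportional
        let M : (F → ℕ) → X → K := fun e => ∏ p, p.1.2 ^ e p
        have hMR : ∀ e, M e ∈ coordRing K X := fun e =>
          prod_mem fun p _ => pow_mem (hF p.1 p.2).1 _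
        have hMχ : ∀ e, HasWeight (∑ p, e p • p.1.1) (M e) := by
          intro e
          have : ∀ s : Finset F, HasWeight (∑ p ∈ s, e p • p.1.1) (∏ p ∈ s, p.1.2 ^ e p) := by
            intro s
            induction s using Finset.induction_on with
            | empty => simpa using HasWeight.one
            | insert p s hp ih =>
              rw [Finset.sum_insert hp, Finset.prod_insert hp]
              exact ((hF p.1 p.2).2.2.pow _).mul ih
          exact this Finset.univ
        have hMx : ∀ e, M e x₀ = ((∏ p, r p ^ e p : Kˣ) : K) * M e x := by
          intro e
          simp only [M, Finset.prod_apply, Pi.pow_apply, Units.coe_prod, Units.val_pow_eq_pow_val]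
          rw [← Finset.prod_mul_distrib]
          exact Finset.prod_congr rfl fun p _ => by rw [← mul_pow, hr]
        have hM0 : ∀ e, M e x₀ ≠ 0 := fun e => by
          simp only [M, Finset.prod_apply, Pi.pow_apply]
          exact Finset.prod_ne_zero_iff.2 fun p _ => pow_ne_zero _ (hx₀' p.1 p.2)
        let e₁ : F → ℕ := fun p => (m p).toNat
        let e₂ : F → ℕ := fun p => (-m p).toNat
        have hme : ∀ p, m p = (e₁ p : ℤ) - e₂ p := fun p => by simp only [e₁, e₂]; omega
        have hwt : ∑ p, e₁ p • p.1.1 = ∑ p, e₂ p • p.1.1 := by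
          rw [← sub_eq_zero]
          refine (Finset.sum_sub_distrib (G := characterLattice K T) _ _).symm.trans ?_
          refine Eq.trans ?_ hm
          exact Finset.sum_congr rfl fun p _ => by
            rw [hme p, sub_smul, natCast_zsmul, natCast_zsmul]
        obtain ⟨c, hc⟩ := hmf _ _ (hMR e₁) _ (hMR e₂) (hwt ▸ hMχ e₁) (hMχ e₂) fun h =>
          hM0 e₂ (congrFun h x₀)
        have hprod : (∏ p, r p ^ e₁ p : Kˣ) = ∏ p, r p ^ e₂ p := by
          have h1 := congrFun hc x₀
          have h2 := congrFun hc x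
          rw [Pi.smul_apply, smul_eq_mul] at h1 h2
          have hM1 : M e₁ x ≠ 0 := fun h => hM0 e₁ (by rw [hMx, h, mul_zero])
          apply Units.ext
          apply mul_right_cancel₀ hM1
          rw [← hMx, h1, hMx, h2]
          ring
        have h3 : ∑ p, m p • Additive.ofMul (r p) = Additive.ofMul (∏ p, r p ^ m p) := by
          rw [ofMul_prod]; rfl
        rw [h3, ← ofMul_one]
        congr 1
        rw [← div_eq_one.2 hprod, ← Finset.prod_div_distrib]
        exact Finset.prod_congr rfl fun p _ => by
          rw [hme p, zpow_sub, zpow_natCast, zpow_natCast, div_eq_mul_inv])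
    obtain ⟨t, ht⟩ := hT' θ
    have htp : ∀ p : F, charValue K p.1.1 t = r p := fun p => by
      have h1 := hθ (Pi.single p 1)
      simp only [LinearMap.toAddMonoidHom_coe, Fintype.linearCombination_apply_single,
        one_smul] at h1
      rw [ht, h1]; rfl
    refine ⟨t, ?_⟩
    have hxx : (t : G)⁻¹ • x = x₀ := by
      refine hX.ext fun f hf => ?_
      have h1 : Set.EqOn (Pi.evalAlgHom K (fun _ : X => K) ((t : G)⁻¹ • x))
          (Pi.evalAlgHom K (fun _ : X => K) x₀)
          (Algebra.adjoin K (Prod.snd '' (F : Set (characterLattice K T × (X → K))))) := by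
        rw [AlgHom.eqOn_adjoin_iff]
        rintro _ ⟨p, hp, rfl⟩
        have h2 := congrFun ((hF p hp).2.2 t) x
        rw [Pi.smul_apply, htp ⟨p, hp⟩, smul_eq_mul, hr ⟨p, hp⟩] at h2
        exact h2
      exact h1 (hgen hf)
    change (t : G) • x₀ = x
    rw [← hxx, smul_inv_smul]

end Irreducible

/-! ### The root and the weight monoid -/

/-- If `1 ⊗ a` is in the rational span of `S`, a positive multiple of `a` is in the subgroup
generated by `S`. -/
theorem exists_nsmul_mem_closure {M : Type*} [AddCommGroup M] (S : Set M) {a : M}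
    (ha : (1 : ℚ) ⊗ₜ[ℤ] a ∈ Submodule.span ℚ ((fun x => (1 : ℚ) ⊗ₜ[ℤ] x) '' S)) :
    ∃ m : ℕ, 0 < m ∧ m • a ∈ AddSubgroup.closure S := by
  let N := AddSubgroup.toIntSubmodule (AddSubgroup.closure S)
  let q : ℚ ⊗[ℤ] M →ₗ[ℚ] ℚ ⊗[ℤ] (M ⧸ N) := N.mkQ.baseChange ℚ
  have hq : q ((1 : ℚ) ⊗ₜ[ℤ] a) = 0 := by
    have hle : Submodule.span ℚ ((fun x => (1 : ℚ) ⊗ₜ[ℤ] x) '' S) ≤ LinearMap.ker q := by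
      rw [Submodule.span_le]
      rintro _ ⟨x, hx, rfl⟩
      have : N.mkQ x = 0 := (Submodule.Quotient.mk_eq_zero N).2 (AddSubgroup.subset_closure hx)
      rw [SetLike.mem_coe, LinearMap.mem_ker, LinearMap.baseChange_tmul, this,
        TensorProduct.tmul_zero]
    exact hle ha
  rw [LinearMap.baseChange_tmul] at hq
  have hloc : IsLocalizedModule (nonZeroDivisors ℤ) (TensorProduct.mk ℤ ℚ (M ⧸ N) 1) :=
    (isLocalizedModule_iff_isBaseChange _ ℚ _).2 (TensorProduct.isBaseChange ℤ (M ⧸ N) ℚ)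
  obtain ⟨c, hc⟩ := (IsLocalizedModule.eq_zero_iff (nonZeroDivisors ℤ)
    (TensorProduct.mk ℤ ℚ (M ⧸ N) 1)).1 hq
  have hc0 : (c : ℤ) ≠ 0 := nonZeroDivisors.coe_ne_zero c
  have hca : (c : ℤ) • a ∈ N := by
    rw [← Submodule.Quotient.mk_eq_zero N]
    exact hc
  refine ⟨(c : ℤ).natAbs, Int.natAbs_pos.2 hc0, ?_⟩
  have hca' : (c : ℤ) • a ∈ AddSubgroup.closure S := hca
  rcases Int.natAbs_eq (c : ℤ) with h | h
  · rw [h, natCast_zsmul] at hca'; exact hca'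
  · rw [h, neg_smul, natCast_zsmul] at hca'; exact neg_mem_iff.1 hca'

section Toric

variable {K : Type*} [Field K] [CharZero K] {G : Type*} [Group G]
  [RegularFunctions K G] {n : ℕ} {B T : Subgroup G} {α : characterLattice K T}
  {φ : SL2 K × (Fin n → Kˣ) →* G} {X : Type*} [MulAction G X] [RegularFunctions K X]

namespace IsAdaptedCover

omit [CharZero K] in
/-- On a spherical variety, highest-weight vectors of the same weight are proportional. -/
theorem exists_eq_smul_of_uInvariant (h : IsAdaptedCover B T α φ)
    (hX : @IrreducibleSpace X (zariski K X)) (hB : HasOpenOrbit K B X) {χ : characterLattice K T}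
    {f g : X → K} (hf : f ∈ coordRing K X) (hg : g ∈ coordRing K X) (hfχ : HasWeight χ f)
    (hgχ : HasWeight χ g) (hfU : h.UInvariant f) (hgU : h.UInvariant g) (hg0 : g ≠ 0) :
    ∃ c : K, f = c • g := by
  obtain ⟨x, hx⟩ := hB
  have hsemi : ∀ f : X → K, HasWeight χ f → h.UInvariant f → ∀ b ∈ B, ∃ c : K,
      translate K b f = c • f := by
    intro f hfχ hfU b hb
    obtain ⟨a, z, s, rfl⟩ := h.borel b hb
    exact ⟨_, by rw [translate_mul_apply, hfU]; exact hfχ (h.torusElt a z)⟩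
  have hgx : g x ≠ 0 := fun hgx =>
    hg0 (eq_zero_of_semiInvariant hX hx hg (hsemi g hgχ hgU) hgx)
  refine ⟨f x / g x, sub_eq_zero.1 (eq_zero_of_semiInvariant hX hx
    (sub_mem hf (Subalgebra.smul_mem _ hg _)) (hsemi _ ?_ ?_) ?_)⟩
  · intro t
    rw [translate_sub, translate_smul, hfχ, hgχ, smul_sub, smul_comm]
  · intro s
    rw [translate_sub, translate_smul, hfU, hgU]
  · simp [hgx]

/-- Along the unipotent radical of `B`, the translates of `f` form a polynomial curve of degree
less than `N`. -/
def OrbitDegreeLT (_ : IsAdaptedCover B T α φ) (f : X → K) (N : ℕ) : Prop :=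
  ∃ w : ℕ → X → K, (∀ i, w i ∈ coordRing K X) ∧
    ∀ s, translate K (φ (upper s, 1)) f = ∑ i ∈ Finset.range N, s ^ i • w i

omit [CharZero K] in
/-- Every nonzero weight vector has a leading coefficient along the unipotent radical of `B`; it is
a highest-weight vector. -/
theorem exists_leadingCoeff (h : IsAdaptedCover B T α φ) (hG : IsLinearAlgebraicGroup K G)
    (hact : IsRegularAction K G X) {f : X → K} (hf : f ∈ coordRing K X) (hf0 : f ≠ 0) :
    ∃ (m : ℕ) (w : ℕ → X → K), (∀ i, w i ∈ coordRing K X) ∧ w m ≠ 0 ∧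
      (∀ s, translate K (φ (upper s, 1)) f = ∑ i ∈ Finset.range (m + 1), s ^ i • w i) ∧
      ∀ N, h.OrbitDegreeLT f N → m < N := by
  classical
  have hex : ∃ N, h.OrbitDegreeLT f N :=
    exists_translate_curve hG hact hf (h.regular.comp isRegularMap_upper_one)
  obtain ⟨w, hw, hexp⟩ := Nat.find_spec hex
  have hmin : ∀ N, h.OrbitDegreeLT f N → Nat.find hex ≤ N := fun N hN => Nat.find_min' hex hN
  generalize Nat.find hex = N at hexp hmin
  cases N with
  | zero =>
    have := hexp 0
    rw [Finset.range_zero, Finset.sum_empty, ← translate_zero (φ (upper 0, 1))] at this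
    exact absurd (translate_injective _ this) hf0
  | succ m =>
    refine ⟨m, w, hw, fun hwm => ?_, hexp, hmin⟩
    have := hmin m ⟨w, hw, fun s => by
      rw [hexp, Finset.sum_range_succ, hwm, smul_zero, add_zero]⟩
    omega

omit [CharZero K] in
/-- Two different shifts of a weight by multiples of the root cannot both be in the weight monoid
if the root is not in its rational span. -/
theorem root_mem_weightSpan {χ : characterLattice K T} {m m' : ℕ} (hne : m ≠ m')
    (hm : χ + m • α ∈ weightMonoid K B T X) (hm' : χ + m' • α ∈ weightMonoid K B T X) :
    (1 : ℚ) ⊗ₜ[ℤ] α ∈ weightSpan K B T X := by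
  have h1 : ∀ ψ ∈ weightMonoid K B T X, (1 : ℚ) ⊗ₜ[ℤ] ψ ∈ weightSpan K B T X :=
    fun ψ hψ => Submodule.subset_span ⟨ψ, hψ, rfl⟩
  have h2 := sub_mem (h1 _ hm) (h1 _ hm')
  have h3 : (1 : ℚ) ⊗ₜ[ℤ] (χ + m • α) - (1 : ℚ) ⊗ₜ[ℤ] (χ + m' • α) =
      ((m : ℚ) - m') • ((1 : ℚ) ⊗ₜ[ℤ] α) := by
    rw [TensorProduct.tmul_add, TensorProduct.tmul_add, TensorProduct.tmul_smul,
      TensorProduct.tmul_smul, add_sub_add_left_eq_sub, sub_smul, Nat.cast_smul_eq_nsmul,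
      Nat.cast_smul_eq_nsmul]
  rw [h3] at h2
  exact (Submodule.smul_mem_iff _ (sub_ne_zero.2 (Nat.cast_injective.ne hne))).1 h2

/-- If the root is not in the rational span of the weight monoid of a spherical variety `X`, the
`T`-weight spaces of `K[X]` are at most one-dimensional. -/
theorem multiplicityFree (h : IsAdaptedCover B T α φ) (hG : IsLinearAlgebraicGroup K G)
    (hact : IsRegularAction K G X) (hX : @IrreducibleSpace X (zariski K X))
    (hB : HasOpenOrbit K B X) (hα : (1 : ℚ) ⊗ₜ[ℤ] α ∉ weightSpan K B T X)
    {χ : characterLattice K T} {f g : X → K} (hf : f ∈ coordRing K X) (hg : g ∈ coordRing K X)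
    (hfχ : HasWeight χ f) (hgχ : HasWeight χ g) (hg0 : g ≠ 0) : ∃ c : K, f = c • g := by
  have hmem : ∀ (f : X → K), HasWeight χ f → ∀ (m : ℕ) (w : ℕ → X → K),
      (∀ i, w i ∈ coordRing K X) → w m ≠ 0 →
      (∀ s, translate K (φ (upper s, 1)) f = ∑ i ∈ Finset.range (m + 1), s ^ i • w i) →
      χ + m • α ∈ weightMonoid K B T X := by
    intro f hfχ m w hw hwm hexp
    obtain ⟨hU, hχ⟩ := h.leadingCoeff_uInvariant hfχ hexp
    exact h.mem_weightMonoid_of_uInvariant hG hact (hw m) hwm hU hχ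
  by_contra! hne
  have hf0 : f ≠ 0 := fun h0 => hne 0 (by rw [h0, zero_smul])
  obtain ⟨m, w, hw, hwm, hexp, -⟩ := h.exists_leadingCoeff hG hact hf hf0
  obtain ⟨m', w', hw', hwm', hexp', -⟩ := h.exists_leadingCoeff hG hact hg hg0
  have hΓ := hmem f hfχ m w hw hwm hexp
  by_cases hmm : m = m'
  · subst hmm
    obtain ⟨hU, hχ⟩ := h.leadingCoeff_uInvariant hfχ hexp
    obtain ⟨hU', hχ'⟩ := h.leadingCoeff_uInvariant hgχ hexp'
    obtain ⟨c, hc⟩ := h.exists_eq_smul_of_uInvariant hX hB (hw m) (hw' m) hχ hχ' hU hU' hwm'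
    -- cancelling the leading coefficients gives a weight vector of smaller degree
    have hd0 : f - c • g ≠ 0 := sub_ne_zero.2 (hne c)
    have hdχ : HasWeight χ (f - c • g) := fun t => by
      rw [translate_sub, translate_smul, hfχ, hgχ, smul_sub, smul_comm]
    obtain ⟨k, v, hv, hvk, hexpk, hmin⟩ := h.exists_leadingCoeff hG hact
      (sub_mem hf (Subalgebra.smul_mem _ hg c)) hd0
    have hk : k < m := hmin m ⟨fun i => w i - c • w' i,
      fun i => sub_mem (hw i) (Subalgebra.smul_mem _ (hw' i) c), fun s => by
        rw [translate_sub, translate_smul, hexp, hexp', Finset.smul_sum,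
          ← Finset.sum_sub_distrib, Finset.sum_range_succ, smul_comm c, ← smul_sub, hc, sub_self,
          smul_zero, add_zero]
        exact Finset.sum_congr rfl fun i _ => by rw [smul_sub, smul_comm c]⟩
    exact hα (root_mem_weightSpan hk.ne (hmem _ hdχ k v hv hvk hexpk) hΓ)
  · exact hα (root_mem_weightSpan hmm hΓ (hmem g hgχ m' w' hw' hwm' hexp'))

variable [IsAlgClosed K]

/-- The elements of the group generated by the weight monoid are differences of weights of
highest-weight vectors. -/
theorem exists_uInvariant_pair_of_mem_closure (h : IsAdaptedCover B T α φ)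
    (hX : @IrreducibleSpace X (zariski K X)) {ψ : characterLattice K T}
    (hψ : ψ ∈ AddSubgroup.closure (weightMonoid K B T X)) :
    ∃ (p q : characterLattice K T) (F F' : X → K), ψ + q = p ∧
      (F ∈ coordRing K X ∧ F ≠ 0 ∧ h.UInvariant F ∧ HasWeight p F) ∧
      (F' ∈ coordRing K X ∧ F' ≠ 0 ∧ h.UInvariant F' ∧ HasWeight q F') := by
  have hone : (1 : X → K) ∈ coordRing K X ∧ (1 : X → K) ≠ 0 ∧ h.UInvariant (1 : X → K) ∧
      HasWeight (0 : characterLattice K T) (1 : X → K) := by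
    refine ⟨one_mem _, ?_, fun s => rfl, HasWeight.one⟩
    let _ := zariski K X
    obtain ⟨x⟩ := hX.toNonempty
    exact Function.ne_iff.2 ⟨x, one_ne_zero⟩
  induction hψ using AddSubgroup.closure_induction with
  | mem ψ hψ =>
    obtain ⟨v, hv, hv0, hvU, hvχ⟩ := h.exists_uInvariant_of_mem_weightMonoid hψ
    exact ⟨ψ, 0, v, 1, add_zero ψ, ⟨hv, hv0, hvU, hvχ⟩, hone⟩
  | zero => exact ⟨0, 0, 1, 1, add_zero 0, hone, hone⟩
  | add ψ ψ' _ _ hψ hψ' =>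
    obtain ⟨p, q, F, F', e, ⟨a1, a2, a3, a4⟩, ⟨b1, b2, b3, b4⟩⟩ := hψ
    obtain ⟨p', q', D, D', e', ⟨a1', a2', a3', a4'⟩, ⟨b1', b2', b3', b4'⟩⟩ := hψ'
    refine ⟨p + p', q + q', F * D, F' * D', by rw [← e, ← e']; abel,
      ⟨mul_mem a1 a1', mul_ne_zero_of_irreducible hX a1 a1' a2 a2', fun s => ?_, a4.mul a4'⟩,
      ⟨mul_mem b1 b1', mul_ne_zero_of_irreducible hX b1 b1' b2 b2', fun s => ?_, b4.mul b4'⟩⟩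
    · rw [translate_mul, a3, a3']
    · rw [translate_mul, b3, b3']
  | neg ψ _ hψ =>
    obtain ⟨p, q, F, F', e, hF, hF'⟩ := hψ
    exact ⟨q, p, F', F, by rw [← e]; abel, hF', hF⟩

/-- If `T` has an open orbit in `X`, the root is not in the rational span of the weight monoid. -/
theorem root_notMem_weightSpan (h : IsAdaptedCover B T α φ) (hG : IsLinearAlgebraicGroup K G)
    (hact : IsRegularAction K G X) (hX : @IrreducibleSpace X (zariski K X))
    (hT : HasOpenOrbit K T X) : (1 : ℚ) ⊗ₜ[ℤ] α ∉ weightSpan K B T X := by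
  intro hα
  obtain ⟨m, hm, hmα⟩ := exists_nsmul_mem_closure _ hα
  -- some weight of the monoid pairs nontrivially with the coroot, because the root does
  obtain ⟨χ, hχ, a, hχa⟩ : ∃ χ ∈ weightMonoid K B T X, ∃ a,
      charValue K χ (h.torusElt a 1) ≠ 1 := by
    by_contra! htriv
    have hall : ∀ ψ ∈ AddSubgroup.closure (weightMonoid K B T X), ∀ a,
        charValue K ψ (h.torusElt a 1) = 1 := by
      intro ψ hψ a
      induction hψ using AddSubgroup.closure_induction with
      | mem ψ hψ => exact htriv ψ hψ a
      | zero => rfl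
      | add ψ ψ' _ _ hψ hψ' => rw [charValue_add, hψ, hψ', one_mul]
      | neg ψ _ hψ => rw [charValue_neg, hψ, inv_one]
    have h1 := hall _ hmα (Units.mk0 2 two_ne_zero)
    rw [charValue_nsmul, root_torusElt, Units.val_mk0, ← pow_mul] at h1
    have h2 : (2 : ℕ) ^ (2 * m) = 1 := by exact_mod_cast h1
    have h3 := Nat.one_lt_two_pow (n := 2 * m) (by omega)
    omega
  obtain ⟨v, hv, hv0, hvU, hvχ⟩ := h.exists_uInvariant_of_mem_weightMonoid hχ
  obtain ⟨k, w, hk, hw, hw0, hform⟩ := h.exists_binary_form hG hact hv hv0 hvU hvχ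
  have hk1 : 1 ≤ k := by
    by_contra! hk0
    rw [Nat.lt_one_iff] at hk0
    exact hχa (by rw [hk, hk0, pow_zero])
  have hw1U : ∀ s, translate K (φ (upper s, 1)) (w 1) = w 1 + ((k : K) * s) • v := by
    intro s
    rw [h.upper_smul_coeff hform hk1, Finset.sum_range_succ, Finset.sum_range_one, hw0, add_comm]
    simp
  have hw1χ := h.weight_coeff hvχ hform hk1
  have hkK : (k : K) ≠ 0 := Nat.cast_ne_zero.2 (by omega)
  have hw10 : w 1 ≠ 0 := by
    intro h0
    have := hw1U 1
    rw [h0, translate_zero, zero_add, mul_one] at this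
    exact smul_ne_zero hkK hv0 this.symm
  obtain ⟨p, q, F, F', hpq, ⟨hF, hF0, hFU, hFχ⟩, ⟨hF', hF'0, hF'U, hF'χ⟩⟩ :=
    h.exists_uInvariant_pair_of_mem_closure hX hmα
  -- `w₁ᵐ F` and `vᵐ F'` have the same weight, hence are proportional, but only the second one is
  -- invariant under the unipotent radical
  have hwt : m • (χ - 1 • α) + p = m • χ + q := by
    rw [← hpq, one_smul]
    refine charValue_ext fun t => ?_
    have ht := charValue_ne_zero α t
    rw [charValue_add, charValue_add, charValue_add, charValue_nsmul, charValue_nsmul,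
      charValue_nsmul, sub_eq_add_neg, charValue_add, charValue_neg, mul_pow, inv_pow]
    field_simp
  obtain ⟨c, hc⟩ := exists_eq_smul_of_hasOpenOrbit hX hT
    (mul_mem (pow_mem (hw 1) m) hF) (mul_mem (pow_mem hv m) hF')
    (hwt ▸ (hw1χ.pow m).mul hFχ) ((hvχ.pow m).mul hF'χ)
    (mul_ne_zero_of_irreducible hX (pow_mem hv m) hF'
      (pow_ne_zero_of_irreducible hX hv hv0 m) hF'0)
  have hinv : ∀ s : K, (w 1 + ((k : K) * s) • v) ^ m = w 1 ^ m := by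
    intro s
    have h1 := congrArg (translate K (φ (upper s, 1))) hc
    rw [translate_smul, translate_mul, translate_mul, translate_pow, translate_pow, hw1U, hFU, hvU,
      hF'U, ← hc] at h1
    by_contra hne
    refine mul_ne_zero_of_irreducible hX (sub_mem (pow_mem (add_mem (hw 1)
      (Subalgebra.smul_mem _ hv _)) m) (pow_mem (hw 1) m)) hF (sub_ne_zero.2 hne) hF0 ?_
    rw [sub_mul, h1, sub_self]
  obtain ⟨x, hx⟩ := Function.ne_iff.1 hv0
  have hx' : v x ≠ 0 := hx
  have hconst : ∀ y : K, y ^ m = w 1 x ^ m := by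
    intro y
    have h1 := congrFun (hinv ((y - w 1 x) / (k * v x))) x
    simp only [Pi.pow_apply, Pi.add_apply, Pi.smul_apply, smul_eq_mul] at h1
    rw [← h1]
    congr 1
    field_simp
    ring
  have h0 := hconst 0
  rw [← hconst 1, one_pow, zero_pow (by omega)] at h0
  exact zero_ne_one h0

end IsAdaptedCover
end Toric

end AffVar

theorem mainTheorem10 {K : Type*} [Field K] [IsAlgClosed K] [CharZero K]
    {G : Type*} [Group G] [AffVar.RegularFunctions K G]
    (hG : AffVar.IsLinearAlgebraicGroup K G) (hrank : AffVar.HasSemisimpleRankOne K G)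
    (B T : Subgroup G) (hB : AffVar.IsBorelSubgroup K B) (hT : AffVar.IsMaximalTorus K T)
    (hTB : T ≤ B)
    (α : AffVar.characterLattice K T) (hα : AffVar.IsPositiveRoot K B T α)
    {X : Type*} [AffVar.RegularFunctions K X] [MulAction G X]
    (hX : AffVar.IsAffineVariety K X) (hact : AffVar.IsRegularAction K G X)
    (hsph : AffVar.IsSpherical K B X) :
    AffVar.IsToric K T X ↔ (1 : ℚ) ⊗ₜ[ℤ] α ∉ AffVar.weightSpan K B T X := by
  obtain ⟨n, φ, h⟩ := AffVar.exists_adaptedCover hG hrank hB hT hα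
  have hirr := hsph.1.irreducible
  constructor
  · exact fun htoric => h.root_notMem_weightSpan hG hact hirr htoric.2
  · intro hα'
    refine ⟨hsph.1, AffVar.hasOpenOrbit_of_multiplicityFree hG hX hact hirr
      hT.prop.isDiagonalizable hT.prop.separatesDual ?_⟩
    intro χ f hf g hg hfχ hgχ hg0
    exact h.multiplicityFree hG hact hirr hsph.2 hα' hf hg hfχ hgχ hg0
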